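/- Let $\kappa>0$ (wave number), $R>0$, $k\in\{0,1\}$ and $0<\alpha<1$. Let $m(\rho,t)$ and $u(\rho,t)$ be measurable complex-valued functions ($\rho\ge 0$ the radius, $t=\cos\theta\in[-1,1]$), integrable in $t\in[-1,1]$ for almost every $\rho\in(0,R)$. Let $P_n$ denote the Legendre polynomials and $$m_l(\rho)=\tfrac{2l+1}{2}\int_{-1}^1 m(\rho,t)P_l(t)\,dt,\qquad u_s(\rho)=\tfrac{2s+1}{2}\int_{-1}^1 u(\rho,t)P_s(t)\,dt$$ the Legendre coefficients of $m$ and $u$. For an integer $F\ge 1$ let $$u^T(\rho,t)=u(\rho,t)-\sum_{s=0}^F u_s(\rho)P_s(t)$$ be the tail of the Legendre series of $u$. Let $j_n$ and $h_n^{(1)}$ be the spherical Bessel and Hankel functions of the first kind, and for a function $w(\rho,t)$ put $$(K_nw)(\tilde\rho)=-(2n+1)\kappa^3\int_0^R h_n^{(1)}(\kappa\max(\tilde\rho,\rho))\,j_n(\kappa\min(\tilde\rho,\rho))\Big(\int_{-1}^1 w(\rho,t)\,m(\rho,t)\,P_n(t)\,dt\Big)\rho^2\,d\rho,$$ $$(K^Fw)(\tilde\rho,t)=\sum_{n=0}^F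 (K_nw)(\tilde\rho)\,P_n(t),\qquad \|g\|_\infty=\sup_{\tilde\rho\ge 0,\ -1\le t\le 1}|g(\tilde\rho,t)|.$$ Suppose that there are constants $A,B$ such that, for all integers $l,s\ge 1$ and almost every $\rho\in(0,R)$, $$|m_l(\rho)|\le \frac{A}{l^{k+\alpha}},\qquad |u_s(\rho)|\le \frac{B}{s^{k+2+\alpha}}.$$ Then there is a constant $C$, depending only on $\kappa,R,k,\alpha,A,B$, such that for all $F\ge 1$ $$\|K^Fu^T\|_\infty\le \begin{cases} C\,F^{-(3+2\alpha)} & \text{if } k=1,\\ C\,F^{-(1+2\alpha)} & \text{if } k=0.\end{cases}$$ -/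

import Mathlib

open MeasureTheory
open scoped ENNReal

/-- The Legendre polynomial `P_n`, by Rodrigues' formula. -/
noncomputable def legendreP (n : ℕ) : Polynomial ℝ :=
  Polynomial.C (1 / (2 ^ n * (n.factorial : ℝ))) *
    (Polynomial.derivative^[n]) ((Polynomial.X ^ 2 - 1) ^ n)

/-- The spherical Bessel function of the first kind,
`j_n(z) = ∑_r (-1)^r z^(n+2r) / (2^r r! (2n+2r+1)‼)`, an everywhere convergent power series. -/
noncomputable def sphericalJ (n : ℕ) (z : ℝ) : ℝ :=
  ∑' r : ℕ, (-1) ^ r * z ^ (n + 2 * r) /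
    (2 ^ r * (r.factorial : ℝ) * (Nat.doubleFactorial (2 * n + 2 * r + 1) : ℝ))

/-- The spherical Bessel function of the second kind (for `z > 0`), by its recurrence
`y_(n+1)(z) + y_(n-1)(z) = (2n+1)/z * y_n(z)`. -/
noncomputable def sphericalY : ℕ → ℝ → ℝ
  | 0, z => -Real.cos z / z
  | 1, z => -Real.cos z / z ^ 2 - Real.sin z / z
  | n + 2, z => (2 * (n : ℝ) + 3) / z * sphericalY (n + 1) z - sphericalY n z

/-- The spherical Hankel function of the first kind, `h_n^{(1)} = j_n + i y_n`. -/
noncomputable def sphericalH (n : ℕ) (z : ℝ) : ℂ :=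
  (sphericalJ n z : ℂ) + Complex.I * (sphericalY n z : ℂ)

/-- The `n`-th Legendre coefficient of `t ↦ f ρ t` on `[-1, 1]`, as a function of `ρ`.
A function `f ρ t` stands for an axisymmetric function in spherical coordinates with `t = cos θ`. -/
noncomputable def legendreCoeff (f : ℝ → ℝ → ℂ) (n : ℕ) (ρ : ℝ) : ℂ :=
  (2 * (n : ℂ) + 1) / 2 * ∫ t in (-1 : ℝ)..1, f ρ t * (((legendreP n).eval t : ℝ) : ℂ)

/-- The truncated Legendre series `u^F = ∑_{n ≤ F} u_n(ρ) P_n(t)`. -/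
noncomputable def legendreTrunc (F : ℕ) (u : ℝ → ℝ → ℂ) (ρ t : ℝ) : ℂ :=
  ∑ n ∈ Finset.range (F + 1), legendreCoeff u n ρ * (((legendreP n).eval t : ℝ) : ℂ)

/-- The tail `u^T = u - u^F`. -/
noncomputable def legendreTail (F : ℕ) (u : ℝ → ℝ → ℂ) (ρ t : ℝ) : ℂ :=
  u ρ t - legendreTrunc F u ρ t

/-- The angular integral `I_n(ρ) = ∫_0^π w m P_n(cos θ) sin θ dθ`, written with `t = cos θ`. -/
noncomputable def angularIntegral (m : ℝ → ℝ → ℂ) (n : ℕ) (w : ℝ → ℝ → ℂ) (ρ : ℝ) : ℂ :=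
  ∫ t in (-1 : ℝ)..1, w ρ t * m ρ t * (((legendreP n).eval t : ℝ) : ℂ)

/-- The `n`-th mode of the integral operator, with wave number `κ`, radius `R`, contrast `m`:
`(K_n w)(a) = -(2n+1) κ³ ∫_0^R h_n^{(1)}(κ max(a,ρ)) j_n(κ min(a,ρ)) I_n(ρ) ρ² dρ`. -/
noncomputable def modeOp (κ R : ℝ) (m : ℝ → ℝ → ℂ) (n : ℕ) (w : ℝ → ℝ → ℂ) (a : ℝ) : ℂ :=
  -((2 * (n : ℂ) + 1) * (κ : ℂ) ^ 3) *
    ∫ ρ in (0 : ℝ)..R, sphericalH n (κ * max a ρ) * (sphericalJ n (κ * min a ρ) : ℂ) *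
      angularIntegral m n w ρ * (ρ : ℂ) ^ 2

/-- The truncated operator `(K^F w)(ρ, t) = ∑_{n ≤ F} (K_n w)(ρ) P_n(t)`. -/
noncomputable def truncOp (κ R : ℝ) (m : ℝ → ℝ → ℂ) (F : ℕ) (w : ℝ → ℝ → ℂ) (ρ t : ℝ) : ℂ :=
  ∑ n ∈ Finset.range (F + 1), modeOp κ R m n w ρ * (((legendreP n).eval t : ℝ) : ℂ)

/-- The supremum norm over all radii `ρ ≥ 0` and all `t = cos θ ∈ [-1, 1]`, possibly `∞`. -/
noncomputable def axisymSupNorm (f : ℝ → ℝ → ℂ) : ℝ≥0∞ :=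
  ⨆ ρ ∈ Set.Ici (0 : ℝ), ⨆ t ∈ Set.Icc (-1 : ℝ) 1, ‖f ρ t‖ₑ

/-! For n ≤ F only the coefficients u_s with s > F enter the angular integral of `u^T m P_n`, which
equals ∑_{s>F} u_s ∫ m P_n P_s. The product P_n P_s contains only degrees l ≥ s - n, so each of
these integrals sees only the small coefficients m_l with l ≥ s - n. Cauchy–Schwarz together with
|P_n| ≤ 1 and ‖P_s‖² = 2/(2s+1) bounds it by a multiple of (s-n)^{-(k+α)} s^{-1/2}, up to a loss
s^{1/8} (`norm_integral_mul_legendreP_mul_legendreP_le`).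

In the radial kernel the double factorials of h_n and j_n cancel, leaving (2n+1)|h_n j_n| ≲ min^n /
max^{n+1}; the radial integral of this against ρ² is O(1/(n+1)) (`exists_norm_modeOp_le`).

Counting powers, u_s gives k+2+α, m gives k+α, and summing over s costs 1, which is already the
claimed 2k+1+2α. The factor s^{-1/2} is surplus. It is spent as 1/8 on the sum over l, 1/8 on the
sum over s (convergence of ∑ (s-n)^{-9/8}), and 1/4 on the harmonic sum over n, so that no logarithm
survives. -/

/-! ### Legendre polynomials: differential equation, orthogonality, uniform bound -/

section Legendre
open Polynomial

/-- The power v = (X² - 1)^n satisfies (X² - 1) v' = 2n X v. Differentiating this once, and then n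
more times by Leibniz, gives the equation for the n-th derivative of v. -/
theorem legendreP_ode (n : ℕ) :
    (X ^ 2 - 1) * derivative (derivative (legendreP n)) + C 2 * X * derivative (legendreP n) =
      C ((n : ℝ) * (n + 1)) * legendreP n := by
  set v : ℝ[X] := (X ^ 2 - 1) ^ n with hv
  have h1 : derivative v * (X ^ 2 - 1) = C (2 * (n : ℝ)) * (X * v) := by
    rcases n with _ | n
    · simp [hv]
    · simp only [hv, derivative_pow, derivative_sub, derivative_X, derivative_one]
      simp only [Nat.add_sub_cancel, map_mul, map_natCast, map_ofNat]
      push_cast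
      ring
  have h2 : derivative^[2] v * X ^ 2 - derivative^[2] v + C (2 - 2 * (n : ℝ)) * (derivative v * X)
      - C (2 * (n : ℝ)) * v = 0 := by
    have := congrArg derivative h1
    simp only [derivative_mul, derivative_sub, derivative_pow, derivative_X, derivative_one,
      derivative_C] at this
    simp only [Function.iterate_succ, Function.iterate_zero, Function.comp, id, map_sub, map_mul,
      map_natCast, map_ofNat] at this ⊢
    push_cast at this
    linear_combination this
  have h3 := congrArg (derivative^[n]) h2
  rw [iterate_derivative_sub, iterate_map_add derivative, iterate_derivative_sub,
    iterate_derivative_C_mul, iterate_derivative_C_mul,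
    iterate_derivative_derivative_mul_X_sq, iterate_derivative_derivative_mul_X,
    iterate_derivative_zero] at h3
  have e1 : derivative^[n] (derivative^[2] v) = derivative (derivative (derivative^[n] v)) := by
    rw [← Function.iterate_add_apply, add_comm, Function.iterate_add_apply]; rfl
  have e2 : derivative^[n + 1] v = derivative (derivative^[n] v) :=
    Function.iterate_succ_apply' _ _ _
  have e3 : derivative^[n + 2] v = derivative (derivative (derivative^[n] v)) := by
    rw [Function.iterate_succ_apply', Function.iterate_succ_apply']
  rw [e1] at h3
  simp only [e2, e3, map_sub, map_mul, map_natCast, map_ofNat, nsmul_eq_mul] at h3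
  have h4 : ((n * (n - 1) : ℕ) : ℝ[X]) = (n : ℝ[X]) * n - n := by
    rcases n with _ | n
    · simp
    · push_cast [Nat.add_sub_cancel]; ring
  simp only [legendreP, derivative_mul, derivative_C, zero_mul, zero_add, ← hv]
  simp only [map_mul, map_natCast, map_add, map_one, map_ofNat]
  push_cast at h3 h4
  linear_combination (C (1 / (2 ^ n * (n.factorial : ℝ)))) * h3 -
    (C (1 / (2 ^ n * (n.factorial : ℝ)))) * derivative^[n] v * h4

/-- This gives the endpoint values at once: around r = ±1 the polynomial (X² - 1)^n becomes (X ±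
2)^n X^n, whose n-th coefficient is (±2)^n. -/
theorem eval_legendreP_eq_taylor (n : ℕ) (r : ℝ) :
    (legendreP n).eval r = (taylor r ((X ^ 2 - 1) ^ n)).coeff n / 2 ^ n := by
  rw [taylor_coeff, legendreP, eval_mul, eval_C]
  have := congrArg (eval r) (congrFun (factorial_smul_hasseDeriv (R := ℝ) n) ((X ^ 2 - 1) ^ n))
  rw [← this]
  rw [LinearMap.smul_apply, eval_smul, nsmul_eq_mul]
  have : (n.factorial : ℝ) ≠ 0 := by positivity
  field_simp

theorem eval_one_legendreP (n : ℕ) : (legendreP n).eval 1 = 1 := by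
  rw [eval_legendreP_eq_taylor]
  have : taylor (1 : ℝ) ((X ^ 2 - 1) ^ n) = (X + C 2) ^ n * X ^ n := by
    rw [taylor_pow, ← mul_pow]
    congr 1
    simp only [taylor_apply, sub_comp, pow_comp, X_comp, one_comp, map_ofNat, map_one]
    ring
  rw [this, coeff_mul_X_pow']
  simp [coeff_X_add_C_pow]

theorem eval_neg_one_legendreP (n : ℕ) : (legendreP n).eval (-1) = (-1) ^ n := by
  rw [eval_legendreP_eq_taylor]
  have : taylor (-1 : ℝ) ((X ^ 2 - 1) ^ n) = (X + C (-2)) ^ n * X ^ n := by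
    rw [taylor_pow, ← mul_pow]
    congr 1
    simp only [taylor_apply, sub_comp, pow_comp, X_comp, one_comp, map_neg, map_ofNat, map_one]
    ring
  rw [this, coeff_mul_X_pow']
  simp only [le_refl, if_true, Nat.sub_self, coeff_X_add_C_pow]
  rw [Nat.sub_zero, Nat.choose_zero_right, Nat.cast_one, mul_one, ← div_pow]
  norm_num

theorem natDegree_legendreP (n : ℕ) : (legendreP n).natDegree = n := by
  have hm : ((X ^ 2 - 1 : ℝ[X]) ^ n).Monic := (monic_X_pow_sub_C (1 : ℝ) two_ne_zero).pow n
  have hd : ((X ^ 2 - 1 : ℝ[X]) ^ n).natDegree = n + n := by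
    have : (X ^ 2 - 1 : ℝ[X]).natDegree = 2 := natDegree_X_pow_sub_C (r := (1 : ℝ))
    rw [natDegree_pow, this]; ring
  have hc : (1 / (2 ^ n * (n.factorial : ℝ))) ≠ 0 := by positivity
  rw [legendreP, natDegree_C_mul hc]
  apply le_antisymm
  · exact (natDegree_iterate_derivative _ _).trans (by omega)
  · apply le_natDegree_of_ne_zero
    rw [coeff_iterate_derivative, ← hd, hm.coeff_natDegree, hd]
    simp [Nat.descFactorial_eq_zero_iff_lt]

theorem integral_eval_derivative (p : ℝ[X]) (a b : ℝ) :
    ∫ x in a..b, (derivative p).eval x = p.eval b - p.eval a :=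
  intervalIntegral.integral_eq_sub_of_hasDerivAt (fun x _ => p.hasDerivAt x)
    ((derivative p).continuous.intervalIntegrable _ _)

theorem integral_legendreP_mul_of_ne {n l : ℕ} (h : n ≠ l) :
    ∫ x in (-1 : ℝ)..1, (legendreP n).eval x * (legendreP l).eval x = 0 := by
  -- The weighted Wronskian: it vanishes at ±1, and by the two differential equations its derivative
  -- is (n(n+1) - l(l+1)) P_n P_l.
  set W : ℝ[X] := (X ^ 2 - 1) * (derivative (legendreP n) * legendreP l -
    legendreP n * derivative (legendreP l)) with hW
  have hd : derivative W = C ((n : ℝ) * (n + 1) - l * (l + 1)) * (legendreP n * legendreP l) := by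
    have h1 := legendreP_ode n
    have h2 := legendreP_ode l
    simp only [hW, derivative_mul, derivative_pow, derivative_X, derivative_one,
      map_sub, map_ofNat, Nat.cast_ofNat] at h1 h2 ⊢
    linear_combination legendreP l * h1 - legendreP n * h2
  have h1 := integral_eval_derivative W (-1) 1
  rw [hd] at h1
  simp only [eval_mul, eval_C, intervalIntegral.integral_const_mul] at h1
  have h2 : W.eval 1 - W.eval (-1) = 0 := by simp [hW]
  rw [h2] at h1
  refine (mul_eq_zero.mp h1).resolve_left fun h0 => h ?_
  have : ((n : ℝ) - l) * (n + l + 1) = 0 := by linear_combination h0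
  rcases mul_eq_zero.mp this with h3 | h3
  · exact_mod_cast sub_eq_zero.mp h3
  · have : (0 : ℝ) < n + l + 1 := by positivity
    linarith

theorem exists_eq_sum_legendreP (N : ℕ) (Q : ℝ[X]) (hQ : Q.natDegree < N) :
    ∃ a : ℕ → ℝ, Q = ∑ l ∈ Finset.range N, C (a l) * legendreP l := by
  induction N generalizing Q with
  | zero => omega
  | succ N ih =>
    have hl : (legendreP N).coeff N ≠ 0 := by
      have h0 : legendreP N ≠ 0 := fun h => by simpa [h] using eval_one_legendreP N
      have := leadingCoeff_ne_zero.mpr h0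
      rwa [leadingCoeff, natDegree_legendreP] at this
    set c := Q.coeff N / (legendreP N).coeff N with hc
    have hcoef : (Q - C c * legendreP N).coeff N = 0 := by
      rw [coeff_sub, coeff_C_mul, hc, div_mul_cancel₀ _ hl, sub_self]
    have hdeg : (Q - C c * legendreP N).natDegree ≤ N := by
      refine (natDegree_sub_le _ _).trans (max_le (by omega) ?_)
      exact (natDegree_C_mul_le _ _).trans (natDegree_legendreP N).le
    rcases Nat.eq_zero_or_pos N with h0 | hpos
    · subst h0
      refine ⟨fun _ => c, ?_⟩
      have := eq_C_of_natDegree_le_zero hdeg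
      rw [hcoef, C_0, sub_eq_zero] at this
      simpa using this
    · have hlt : (Q - C c * legendreP N).natDegree < N := by
        refine lt_of_le_of_ne hdeg fun h => ?_
        have h1 : (Q - C c * legendreP N).leadingCoeff = 0 := by rw [leadingCoeff, h, hcoef]
        rw [leadingCoeff_eq_zero] at h1
        rw [h1, natDegree_zero] at h
        omega
      obtain ⟨a, ha⟩ := ih _ hlt
      refine ⟨fun l => if l = N then c else a l, ?_⟩
      simp only [Finset.sum_range_succ, if_true]
      rw [← sub_eq_iff_eq_add, ha]
      refine Finset.sum_congr rfl fun l hl => ?_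
      rw [if_neg (Finset.mem_range.mp hl).ne]

theorem integral_sum_legendreP_mul (N n : ℕ) (a : ℕ → ℝ) :
    ∫ x in (-1 : ℝ)..1, (∑ l ∈ Finset.range N, C (a l) * legendreP l).eval x *
      (legendreP n).eval x =
    if n < N then a n * ∫ x in (-1 : ℝ)..1, (legendreP n).eval x * (legendreP n).eval x else 0 := by
  have : ∀ x : ℝ, (∑ l ∈ Finset.range N, C (a l) * legendreP l).eval x * (legendreP n).eval x =
      ∑ l ∈ Finset.range N, a l * ((legendreP l).eval x * (legendreP n).eval x) := by
    intro x
    simp only [eval_finsetSum, eval_mul, eval_C, Finset.sum_mul, mul_assoc]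
  simp only [this]
  rw [intervalIntegral.integral_finsetSum]
  · simp only [intervalIntegral.integral_const_mul]
    split_ifs with h
    · refine Finset.sum_eq_single_of_mem n (Finset.mem_range.mpr h) fun l _ hl => ?_
      rw [integral_legendreP_mul_of_ne hl, mul_zero]
    · refine Finset.sum_eq_zero fun l hl => ?_
      rw [integral_legendreP_mul_of_ne, mul_zero]
      rintro rfl
      exact h (Finset.mem_range.mp hl)
  · intro l _
    exact Continuous.intervalIntegrable (by fun_prop) _ _

theorem integral_mul_legendreP_of_natDegree_lt {n : ℕ} {Q : ℝ[X]} (hQ : Q.natDegree < n) :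
    ∫ x in (-1 : ℝ)..1, Q.eval x * (legendreP n).eval x = 0 := by
  obtain ⟨a, ha⟩ := exists_eq_sum_legendreP n Q hQ
  rw [ha, integral_sum_legendreP_mul, if_neg (lt_irrefl n)]

theorem integral_legendreP_sq (n : ℕ) :
    ∫ x in (-1 : ℝ)..1, (legendreP n).eval x * (legendreP n).eval x = 2 / (2 * n + 1) := by
  rcases Nat.eq_zero_or_pos n with h0 | hn
  · subst h0
    simp [legendreP]
    norm_num
  set P := legendreP n with hP
  have hI : ∀ Q : ℝ[X], IntervalIntegrable (fun x => Q.eval x) volume (-1) 1 :=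
    fun Q => Q.continuous.intervalIntegrable _ _
  -- The degree-n terms of X P' and n P cancel, so the difference has degree below n and is
  -- orthogonal to P. Integrating (X P²)' = 2 (X P' - n P) P + (2n+1) P² then leaves only the
  -- boundary value 2.
  have h1 : ∫ x in (-1 : ℝ)..1, (X * derivative P - C (n : ℝ) * P).eval x * P.eval x = 0 := by
    apply integral_mul_legendreP_of_natDegree_lt
    have hdeg : (X * derivative P - C (n : ℝ) * P).natDegree ≤ n := by
      refine (natDegree_sub_le _ _).trans (max_le ?_ ?_)
      · refine natDegree_mul_le.trans ?_
        have := natDegree_derivative_le P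
        rw [hP, natDegree_legendreP] at this
        rw [natDegree_X, hP]
        omega
      · exact (natDegree_C_mul_le _ _).trans (natDegree_legendreP n).le
    refine lt_of_le_of_ne hdeg fun h => ?_
    have h1 : (X * derivative P - C (n : ℝ) * P).coeff n = 0 := by
      obtain ⟨m, rfl⟩ : ∃ m, n = m + 1 := ⟨n - 1, by omega⟩
      rw [coeff_sub, coeff_X_mul, coeff_derivative, coeff_C_mul]
      push_cast
      ring
    have h2 : (X * derivative P - C (n : ℝ) * P).leadingCoeff = 0 := by rw [leadingCoeff, h, h1]
    rw [leadingCoeff_eq_zero] at h2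
    rw [h2, natDegree_zero] at h
    omega
  have h2 := integral_eval_derivative (X * P ^ 2) (-1) 1
  have h3 : ∀ x : ℝ, (derivative (X * P ^ 2)).eval x =
      2 * ((X * derivative P - C (n : ℝ) * P).eval x * P.eval x) +
        (2 * n + 1) * (P.eval x * P.eval x) := by
    intro x
    simp [derivative_pow]
    ring
  simp only [h3] at h2
  rw [intervalIntegral.integral_add, intervalIntegral.integral_const_mul,
    intervalIntegral.integral_const_mul, h1] at h2
  · simp only [hP, eval_mul, eval_pow, eval_X, eval_one_legendreP, eval_neg_one_legendreP,
      ← pow_mul, mul_comm n 2] at h2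
    rw [pow_mul] at h2
    rw [eq_div_iff (by positivity)]
    norm_num at h2
    linarith
  · exact Continuous.intervalIntegrable (by fun_prop) _ _
  · exact Continuous.intervalIntegrable (by fun_prop) _ _

theorem abs_eval_legendreP_le_one (n : ℕ) {x : ℝ} (hx : x ∈ Set.Icc (-1 : ℝ) 1) :
    |(legendreP n).eval x| ≤ 1 := by
  rcases Nat.eq_zero_or_pos n with h0 | hn
  · subst h0; simp [legendreP]
  set N : ℝ := n * (n + 1) with hN
  have hNpos : 0 < N := by positivity
  set P := legendreP n with hP
  -- A Sonin-type energy: the differential equation gives E' = 2x P'²/N, so E grows away from 0 in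
  -- both directions. Hence P² ≤ E ≤ E(±1) = 1.
  set E : ℝ[X] := P ^ 2 + C N⁻¹ * ((1 - X ^ 2) * derivative P ^ 2) with hE
  have hE' : derivative E = C (2 * N⁻¹) * (X * derivative P ^ 2) := by
    have h1 := legendreP_ode n
    rw [← hP, ← hN] at h1
    have h2 : (C N * C N⁻¹ : ℝ[X]) = 1 := by rw [← C_mul, mul_inv_cancel₀ hNpos.ne', C_1]
    simp only [hE, derivative_add, derivative_mul, derivative_sub, derivative_pow, derivative_X,
      derivative_one, derivative_C, map_mul, map_ofNat, Nat.cast_ofNat] at h1 ⊢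
    linear_combination (-2 * C N⁻¹ * derivative P) * h1 - 2 * P * derivative P * h2
  have hle : E.eval x ≤ 1 := by
    have hd : ∀ y : ℝ, deriv (fun z => E.eval z) y = 2 * N⁻¹ * (y * (derivative P).eval y ^ 2) := by
      intro y
      rw [Polynomial.deriv, hE']
      simp
    rcases le_total 0 x with h | h
    · have hm : MonotoneOn (fun z => E.eval z) (Set.Icc 0 1) := by
        refine monotoneOn_of_deriv_nonneg (convex_Icc _ _) E.continuous.continuousOn
          E.differentiable.differentiableOn fun y hy => ?_
        rw [interior_Icc] at hy
        rw [hd]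
        have := hy.1.le
        positivity
      have := hm ⟨h, hx.2⟩ (Set.right_mem_Icc.mpr zero_le_one) hx.2
      refine this.trans ?_
      simp [hE, hP, eval_one_legendreP]
    · have hm : AntitoneOn (fun z => E.eval z) (Set.Icc (-1) 0) := by
        refine antitoneOn_of_deriv_nonpos (convex_Icc _ _) E.continuous.continuousOn
          E.differentiable.differentiableOn fun y hy => ?_
        rw [interior_Icc] at hy
        rw [hd]
        have h2 : 0 ≤ (derivative P).eval y ^ 2 := by positivity
        exact mul_nonpos_of_nonneg_of_nonpos (by positivity)
          (mul_nonpos_of_nonpos_of_nonneg hy.2.le h2)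
      have := hm (Set.left_mem_Icc.mpr (by norm_num)) ⟨hx.1, h⟩ hx.1
      refine this.trans ?_
      simp [hE, hP, eval_neg_one_legendreP, ← pow_mul]
  have h2 : P.eval x ^ 2 ≤ E.eval x := by
    have : 0 ≤ 1 - x ^ 2 := by nlinarith [hx.1, hx.2]
    simp only [hE, eval_add, eval_pow, eval_mul, eval_C, eval_sub, eval_one, eval_X]
    have : 0 ≤ N⁻¹ * ((1 - x ^ 2) * (derivative P).eval x ^ 2) := by positivity
    linarith
  exact (sq_le_one_iff_abs_le_one _).mp (h2.trans hle)

end Legendre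

/-! ### Bounds for spherical Bessel and Hankel functions -/

section Bessel
open Nat (doubleFactorial)

/-- The `r`-th term of the power series of `sphericalJ n`. -/
noncomputable def sphericalJTerm (n : ℕ) (z : ℝ) (r : ℕ) : ℝ :=
  (-1) ^ r * z ^ (n + 2 * r) /
    (2 ^ r * (r.factorial : ℝ) * (Nat.doubleFactorial (2 * n + 2 * r + 1) : ℝ))

theorem sphericalJ_eq_tsum (n : ℕ) (z : ℝ) : sphericalJ n z = ∑' r, sphericalJTerm n z r := rfl

theorem abs_sphericalJTerm_le (n : ℕ) (z : ℝ) (r : ℕ) :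
    |sphericalJTerm n z r| ≤
      |z| ^ n / doubleFactorial (2 * n + 1) * ((z ^ 2 / 2) ^ r / r.factorial) := by
  have hpos : (0 : ℝ) < doubleFactorial (2 * n + 1) := by
    exact_mod_cast Nat.doubleFactorial_pos _
  have hmono : ∀ r : ℕ, doubleFactorial (2 * n + 1) ≤ doubleFactorial (2 * n + 2 * r + 1) := by
    intro r
    induction r with
    | zero => simp
    | succ r ih =>
      refine ih.trans ?_
      have : 2 * n + 2 * (r + 1) + 1 = (2 * n + 2 * r + 1) + 2 := by ring
      rw [this, Nat.doubleFactorial_add_two]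
      exact Nat.le_mul_of_pos_left _ (by omega)
  have h1 : (doubleFactorial (2 * n + 1) : ℝ) ≤ doubleFactorial (2 * n + 2 * r + 1) := by
    exact_mod_cast hmono r
  have hr : (0 : ℝ) < r.factorial := by positivity
  have h2 : (0 : ℝ) < doubleFactorial (2 * n + 2 * r + 1) := hpos.trans_le h1
  rw [sphericalJTerm, abs_div, abs_mul, abs_pow, abs_pow, abs_neg, abs_one, one_pow, one_mul,
    abs_of_pos (by positivity : (0 : ℝ) < 2 ^ r * r.factorial * doubleFactorial (2 * n + 2 * r + 1)),
    pow_add, pow_mul, sq_abs, div_pow]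
  calc |z| ^ n * (z ^ 2) ^ r / (2 ^ r * r.factorial * doubleFactorial (2 * n + 2 * r + 1))
      ≤ |z| ^ n * (z ^ 2) ^ r / (2 ^ r * r.factorial * doubleFactorial (2 * n + 1)) := by gcongr
    _ = _ := by field_simp

theorem summable_sphericalJTerm (n : ℕ) (z : ℝ) : Summable (sphericalJTerm n z) :=
  Summable.of_norm_bounded ((Real.summable_pow_div_factorial _).mul_left _)
    (abs_sphericalJTerm_le n z)

theorem abs_sphericalJ_le (n : ℕ) {y : ℝ} (hy : 0 ≤ y) :
    |sphericalJ n y| ≤ Real.exp (y ^ 2 / 2) * y ^ n / doubleFactorial (2 * n + 1) := by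
  have h : HasSum (fun r : ℕ => (y ^ 2 / 2) ^ r / r.factorial) (Real.exp (y ^ 2 / 2)) := by
    rw [Real.exp_eq_exp_ℝ]
    exact NormedSpace.expSeries_div_hasSum_exp _
  have := tsum_of_norm_bounded (f := sphericalJTerm n y)
    (h.mul_left (|y| ^ n / doubleFactorial (2 * n + 1))) (abs_sphericalJTerm_le n y)
  rw [← sphericalJ_eq_tsum, Real.norm_eq_abs, abs_of_nonneg hy] at this
  refine this.trans (le_of_eq ?_)
  ring

theorem sphericalJ_add_two (n : ℕ) {z : ℝ} (hz : z ≠ 0) :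
    sphericalJ (n + 2) z = (2 * (n : ℝ) + 3) / z * sphericalJ (n + 1) z - sphericalJ n z := by
  have hs1 := (summable_sphericalJTerm (n + 1) z).mul_left ((2 * (n : ℝ) + 3) / z)
  have hs := hs1.sub (summable_sphericalJTerm n z)
  rw [sphericalJ_eq_tsum, sphericalJ_eq_tsum, sphericalJ_eq_tsum, ← tsum_mul_left,
    ← hs1.tsum_sub (summable_sphericalJTerm n z), hs.tsum_eq_zero_add]
  -- The recurrence holds termwise after a shift: term r of j_{n+2} matches term r + 1 of the
  -- right-hand side, whose term 0 cancels.
  have h0 : (2 * (n : ℝ) + 3) / z * sphericalJTerm (n + 1) z 0 - sphericalJTerm n z 0 = 0 := by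
    have e : 2 * (n + 1) + 2 * 0 + 1 = (2 * n + 1) + 2 := by ring
    have hd : (doubleFactorial (2 * n + 1) : ℝ) ≠ 0 := by
      exact_mod_cast (Nat.doubleFactorial_pos _).ne'
    have hn : (2 * (n : ℝ) + 1 + 2) ≠ 0 := by positivity
    simp only [sphericalJTerm, e, Nat.doubleFactorial_add_two, mul_zero, add_zero]
    push_cast
    field_simp
    ring
  rw [h0, zero_add]
  congr 1
  ext r
  have e1 : 2 * (n + 1) + 2 * (r + 1) + 1 = (2 * n + 2 * r + 3) + 2 := by ring
  have e2 : 2 * n + 2 * (r + 1) + 1 = 2 * n + 2 * r + 3 := by ring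
  have e3 : 2 * (n + 2) + 2 * r + 1 = (2 * n + 2 * r + 3) + 2 := by ring
  have hd : (doubleFactorial (2 * n + 2 * r + 3) : ℝ) ≠ 0 := by
    exact_mod_cast (Nat.doubleFactorial_pos _).ne'
  have hn : (2 * (n : ℝ) + 2 * r + 3 + 2) ≠ 0 := by positivity
  have hr : (r.factorial : ℝ) ≠ 0 := by positivity
  have hr1 : ((r : ℝ) + 1) ≠ 0 := by positivity
  simp only [sphericalJTerm, e1, e2, e3, Nat.doubleFactorial_add_two, Nat.factorial_succ]
  push_cast
  field_simp
  ring

theorem factorial_two_mul_add_one (r : ℕ) :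
    (2 * r + 1).factorial = 2 ^ r * r.factorial * doubleFactorial (2 * r + 1) := by
  rw [Nat.factorial_eq_mul_doubleFactorial, Nat.doubleFactorial_two_mul, mul_comm]

theorem sphericalJ_zero {z : ℝ} (hz : z ≠ 0) : sphericalJ 0 z = Real.sin z / z := by
  have h := (Real.hasSum_sin z).div_const z
  rw [sphericalJ_eq_tsum, ← h.tsum_eq]
  congr 1
  ext r
  rw [sphericalJTerm, factorial_two_mul_add_one]
  push_cast
  simp only [zero_add]
  field_simp
  ring

theorem sphericalJ_one {z : ℝ} (hz : z ≠ 0) :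
    sphericalJ 1 z = Real.sin z / z ^ 2 - Real.cos z / z := by
  have h := ((Real.hasSum_sin z).div_const (z ^ 2)).sub ((Real.hasSum_cos z).div_const z)
  rw [← h.tsum_eq, h.summable.tsum_eq_zero_add, sphericalJ_eq_tsum]
  have h0 : (-1 : ℝ) ^ 0 * z ^ (2 * 0 + 1) / ((2 * 0 + 1).factorial : ℝ) / z ^ 2 -
      (-1) ^ 0 * z ^ (2 * 0) / ((2 * 0).factorial : ℝ) / z = 0 := by
    simp
    field_simp
    simp
  rw [h0, zero_add]
  congr 1
  ext r
  have e : 2 * (r + 1) + 1 = (2 * r + 2) + 1 := by ring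
  have e1 : 2 * 1 + 2 * r + 1 = 2 * (r + 1) + 1 := by ring
  have e2 : 2 * (r + 1) = 2 * r + 1 + 1 := by ring
  have h1 : ((2 * (r + 1)).factorial : ℝ) * (2 * r + 3) =
      2 ^ (r + 1) * ((r + 1 : ℝ) * r.factorial) * doubleFactorial (2 * (r + 1) + 1) := by
    have := factorial_two_mul_add_one (r + 1)
    rw [Nat.factorial_succ (2 * (r + 1)), Nat.factorial_succ r] at this
    have h : (((2 * (r + 1) + 1) * (2 * (r + 1)).factorial : ℕ) : ℝ) =
      ((2 ^ (r + 1) * ((r + 1) * r.factorial) * doubleFactorial (2 * (r + 1) + 1) : ℕ) : ℝ) := by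
      rw [this]
    push_cast at h ⊢
    linarith
  have hd : (doubleFactorial (2 * (r + 1) + 1) : ℝ) ≠ 0 := by
    exact_mod_cast (Nat.doubleFactorial_pos _).ne'
  have hf : ((2 * (r + 1)).factorial : ℝ) ≠ 0 := by positivity
  have hr3 : (2 * (r : ℝ) + 3) ≠ 0 := by positivity
  have hr1 : ((r : ℝ) + 1) ≠ 0 := by positivity
  have hr : (r.factorial : ℝ) ≠ 0 := by positivity
  have h2 : (((2 * (r + 1) + 1).factorial : ℕ) : ℝ) =
      (2 * r + 3) * ((2 * (r + 1)).factorial : ℝ) := by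
    rw [Nat.factorial_succ]; push_cast; ring
  have h3 : (doubleFactorial (2 * (r + 1) + 1) : ℝ) = ((2 * (r + 1)).factorial : ℝ) * (2 * r + 3) /
      (2 ^ (r + 1) * ((r + 1 : ℝ) * r.factorial)) := by
    rw [h1]; field_simp
  rw [sphericalJTerm, e1, h2, h3]
  field_simp
  ring

/-- A positive majorant of the spherical Bessel functions of both kinds, given by their
recurrence with all signs positive. -/
noncomputable def sphericalMajorant : ℕ → ℝ → ℝ
  | 0, z => 1 / z
  | 1, z => 1 / z ^ 2 + 1 / z
  | n + 2, z => (2 * (n : ℝ) + 3) / z * sphericalMajorant (n + 1) z + sphericalMajorant n z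

theorem sphericalMajorant_nonneg {z : ℝ} (hz : 0 < z) : ∀ n, 0 ≤ sphericalMajorant n z
  | 0 => by rw [sphericalMajorant]; positivity
  | 1 => by rw [sphericalMajorant]; positivity
  | n + 2 => by
    have h1 := sphericalMajorant_nonneg hz (n + 1)
    have h2 := sphericalMajorant_nonneg hz n
    rw [sphericalMajorant]
    positivity

/-- With all signs positive, every ingredient of the recurrence decreases in z. The Hankel functions
themselves oscillate; passing to the majorant is what allows their argument to be lowered into (0,
κR]. -/
theorem sphericalMajorant_anti {x y : ℝ} (hx : 0 < x) (hxy : x ≤ y) :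
    ∀ n, sphericalMajorant n y ≤ sphericalMajorant n x
  | 0 => by simp only [sphericalMajorant]; gcongr
  | 1 => by simp only [sphericalMajorant]; gcongr
  | n + 2 => by
    have h1 := sphericalMajorant_anti hx hxy (n + 1)
    have h2 := sphericalMajorant_anti hx hxy n
    have h3 := sphericalMajorant_nonneg (hx.trans_le hxy) (n + 1)
    simp only [sphericalMajorant]
    gcongr

theorem abs_le_sphericalMajorant {z : ℝ} (hz : 0 < z) {f : ℕ → ℝ} (h0 : |f 0| ≤ 1 / z)
    (h1 : |f 1| ≤ 1 / z ^ 2 + 1 / z)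
    (hf : ∀ n : ℕ, f (n + 2) = (2 * (n : ℝ) + 3) / z * f (n + 1) - f n) :
    ∀ n, |f n| ≤ sphericalMajorant n z
  | 0 => h0
  | 1 => h1
  | n + 2 => by
    rw [hf, sphericalMajorant]
    refine (abs_sub _ _).trans ?_
    rw [abs_mul, abs_of_pos (by positivity : 0 < (2 * (n : ℝ) + 3) / z)]
    exact add_le_add (mul_le_mul_of_nonneg_left (abs_le_sphericalMajorant hz h0 h1 hf (n + 1))
      (by positivity)) (abs_le_sphericalMajorant hz h0 h1 hf n)

theorem norm_sphericalH_le (n : ℕ) {z : ℝ} (hz : 0 < z) :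
    ‖sphericalH n z‖ ≤ 2 * sphericalMajorant n z := by
  have hsin : |Real.sin z| ≤ 1 := Real.abs_sin_le_one z
  have hcos : |Real.cos z| ≤ 1 := Real.abs_cos_le_one z
  have hJ : |sphericalJ n z| ≤ sphericalMajorant n z := by
    refine abs_le_sphericalMajorant (f := fun n => sphericalJ n z) hz ?_ ?_
      (fun n => sphericalJ_add_two n hz.ne') n
    · simp only [sphericalJ_zero hz.ne', abs_div, abs_of_pos hz]
      gcongr
    · simp only [sphericalJ_one hz.ne']
      refine (abs_sub _ _).trans ?_
      rw [abs_div, abs_div, abs_of_pos hz, abs_of_pos (pow_pos hz 2)]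
      gcongr
  have hY : |sphericalY n z| ≤ sphericalMajorant n z := by
    refine abs_le_sphericalMajorant (f := fun n => sphericalY n z) hz ?_ ?_
      (fun n => by simp only [sphericalY]) n
    · simp only [sphericalY, abs_div, abs_of_pos hz, abs_neg]
      gcongr
    · simp only [sphericalY]
      refine (abs_sub _ _).trans ?_
      rw [abs_div, abs_div, abs_of_pos hz, abs_of_pos (pow_pos hz 2), abs_neg]
      gcongr
  rw [sphericalH]
  refine (norm_add_le _ _).trans ?_
  rw [norm_mul, Complex.norm_I, one_mul, Complex.norm_real, Complex.norm_real, Real.norm_eq_abs,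
    Real.norm_eq_abs]
  linarith

theorem sphericalMajorant_le (n : ℕ) {z Z : ℝ} (hz : 0 < z) (hZ : z ≤ Z) :
    (2 * n + 1) * sphericalMajorant n z ≤
      (1 + Z) * Real.exp (Z ^ 2 / 2) * doubleFactorial (2 * n + 1) / z ^ (n + 1) := by
  -- Normalised by the expected growth (2n+1)!!/z^{n+1}, the recurrence becomes b_{n+2} = b_{n+1} +
  -- z²/((2n+1)(2n+3)) b_n, so b is nondecreasing and each step multiplies it by at most 1 +
  -- Z²/((2n+1)(2n+3)).
  set b : ℕ → ℝ := fun n =>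
    (2 * n + 1) * sphericalMajorant n z * z ^ (n + 1) / doubleFactorial (2 * n + 1) with hb
  have hd : ∀ n : ℕ, (0 : ℝ) < doubleFactorial (2 * n + 1) := fun n => by
    exact_mod_cast Nat.doubleFactorial_pos _
  have hbn : ∀ n, 0 ≤ b n := fun n => by
    have := sphericalMajorant_nonneg hz n
    have := hd n
    simp only [hb]
    positivity
  have hrec : ∀ n : ℕ, b (n + 2) = b (n + 1) + z ^ 2 / ((2 * n + 1) * (2 * n + 3)) * b n := by
    intro n
    have e1 : 2 * (n + 2) + 1 = (2 * n + 1) + 2 + 2 := by ring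
    have e2 : 2 * (n + 1) + 1 = (2 * n + 1) + 2 := by ring
    have := (hd n).ne'
    have h1 : (2 * (n : ℝ) + 1) ≠ 0 := by positivity
    have h3 : (2 * (n : ℝ) + 3) ≠ 0 := by positivity
    have h5 : (2 * (n : ℝ) + 5) ≠ 0 := by positivity
    simp only [hb, sphericalMajorant, e1, e2, Nat.doubleFactorial_add_two]
    push_cast
    have h3' : (2 * (n : ℝ) + 1 + 2) = 2 * n + 3 := by ring
    have h5' : (2 * (n : ℝ) + 3 + 2) = 2 * n + 5 := by ring
    rw [h3', h5']
    field_simp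
    ring
  have hb0 : b 0 = 1 := by simp [hb, sphericalMajorant, hz.ne']
  have hb1 : b 1 = 1 + z := by
    simp only [hb, sphericalMajorant]
    norm_num [Nat.doubleFactorial]
    field_simp
  -- The exponent is the telescoped sum of Z²/((2j+1)(2j+3)) = (Z²/2)(1/(2j+1) - 1/(2j+3)) over j <
  -- n.
  have key : ∀ n : ℕ, b n ≤ b (n + 1) ∧
      b (n + 1) ≤ (1 + Z) * Real.exp (Z ^ 2 / 2 * (1 - 1 / (2 * n + 1))) := by
    intro n
    induction n with
    | zero =>
      rw [hb0, zero_add, hb1]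
      norm_num
      exact ⟨hz.le, hZ⟩
    | succ n ih =>
      refine ⟨?_, ?_⟩
      · rw [hrec]
        have := hbn n
        have : 0 ≤ z ^ 2 / ((2 * n + 1) * (2 * n + 3)) * b n := by positivity
        linarith
      · rw [hrec]
        have hs : 0 ≤ Z ^ 2 / ((2 * n + 1) * (2 * n + 3)) := by positivity
        calc b (n + 1) + z ^ 2 / ((2 * n + 1) * (2 * n + 3)) * b n
            ≤ b (n + 1) + Z ^ 2 / ((2 * n + 1) * (2 * n + 3)) * b (n + 1) := by
              have := ih.1
              have := hbn n
              gcongr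
          _ = (Z ^ 2 / ((2 * n + 1) * (2 * n + 3)) + 1) * b (n + 1) := by ring
          _ ≤ Real.exp (Z ^ 2 / ((2 * n + 1) * (2 * n + 3))) *
                ((1 + Z) * Real.exp (Z ^ 2 / 2 * (1 - 1 / (2 * n + 1)))) :=
              mul_le_mul (Real.add_one_le_exp _) ih.2 (hbn _) (Real.exp_nonneg _)
          _ = _ := by
              rw [mul_left_comm, ← Real.exp_add]
              congr 2
              push_cast
              have h1 : (2 * (n : ℝ) + 1) ≠ 0 := by positivity
              have h3 : (2 * (n : ℝ) + 3) ≠ 0 := by positivity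
              have h3' : (2 * ((n : ℝ) + 1) + 1) ≠ 0 := by positivity
              field_simp
              ring
  have hfin : b n ≤ (1 + Z) * Real.exp (Z ^ 2 / 2) := by
    refine (key n).1.trans ((key n).2.trans ?_)
    have : 0 ≤ 1 + Z := by linarith
    have h1 : 0 ≤ 1 / (2 * (n : ℝ) + 1) := by positivity
    have h2 : Z ^ 2 / 2 * (1 - 1 / (2 * (n : ℝ) + 1)) ≤ Z ^ 2 / 2 := by
      have : 0 ≤ Z ^ 2 / 2 * (1 / (2 * (n : ℝ) + 1)) := by positivity
      linarith
    gcongr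
  simp only [hb] at hfin
  rw [div_le_iff₀ (hd n)] at hfin
  rwa [le_div_iff₀ (by positivity)]

end Bessel

/-! ### The radial kernel and the norm of one mode -/

section Kernel
open Nat (doubleFactorial)

/-- The factors (2n+1)!! in the bounds for h_n and j_n cancel. Capping a at R makes the bound
uniform in a ≥ 0: the minimum is unchanged because ρ ≤ R, and lowering the maximum only increases
the majorant. -/
theorem norm_sphericalH_mul_sphericalJ_le (n : ℕ) {κ R a ρ : ℝ} (hκ : 0 < κ) (hρ : 0 < ρ)
    (hρR : ρ ≤ R) (ha : 0 ≤ a) :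
    (2 * n + 1) * (‖sphericalH n (κ * max a ρ)‖ * ‖(sphericalJ n (κ * min a ρ) : ℂ)‖) ≤
      2 * (1 + κ * R) * Real.exp ((κ * R) ^ 2) / κ *
        (min (min a R) ρ ^ n / max (min a R) ρ ^ (n + 1)) := by
  have hmin : min a ρ = min (min a R) ρ := by
    rw [min_assoc, min_eq_right hρR]
  have hmax : max (min a R) ρ ≤ max a ρ := max_le_max (min_le_left _ _) le_rfl
  set p := max (min a R) ρ with hp
  set q := min (min a R) ρ with hq
  have hp0 : 0 < p := hρ.trans_le (le_max_right _ _)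
  have hq0 : 0 ≤ q := le_min (le_min ha (hρ.le.trans hρR)) hρ.le
  have hpR : p ≤ R := max_le (min_le_right _ _) hρR
  have hqR : q ≤ R := (min_le_right _ _).trans hρR
  have hZ : 0 < κ * R := mul_pos hκ (hp0.trans_le hpR)
  have hd : (0 : ℝ) < doubleFactorial (2 * n + 1) := by
    exact_mod_cast Nat.doubleFactorial_pos _
  have h1 : ‖sphericalH n (κ * max a ρ)‖ ≤ 2 * sphericalMajorant n (κ * p) := by
    refine (norm_sphericalH_le n (mul_pos hκ (hρ.trans_le (le_max_right _ _)))).trans ?_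
    have := sphericalMajorant_anti (mul_pos hκ hp0) (mul_le_mul_of_nonneg_left hmax hκ.le) n
    linarith
  have h2 : ‖(sphericalJ n (κ * min a ρ) : ℂ)‖ ≤
      Real.exp ((κ * R) ^ 2 / 2) * (κ * q) ^ n / doubleFactorial (2 * n + 1) := by
    rw [Complex.norm_real, Real.norm_eq_abs, hmin]
    refine (abs_sphericalJ_le n (by positivity)).trans ?_
    gcongr
  have h3 := sphericalMajorant_le n (mul_pos hκ hp0) (mul_le_mul_of_nonneg_left hpR hκ.le)
  have h4 := sphericalMajorant_nonneg (mul_pos hκ hp0) n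
  have hexp : Real.exp ((κ * R) ^ 2) = Real.exp ((κ * R) ^ 2 / 2) * Real.exp ((κ * R) ^ 2 / 2) := by
    rw [← Real.exp_add, add_halves]
  calc (2 * n + 1) * (‖sphericalH n (κ * max a ρ)‖ * ‖(sphericalJ n (κ * min a ρ) : ℂ)‖)
      ≤ (2 * n + 1) * (2 * sphericalMajorant n (κ * p) *
          (Real.exp ((κ * R) ^ 2 / 2) * (κ * q) ^ n / doubleFactorial (2 * n + 1))) := by
        gcongr
    _ = 2 * ((2 * n + 1) * sphericalMajorant n (κ * p)) *
          (Real.exp ((κ * R) ^ 2 / 2) * (κ * q) ^ n / doubleFactorial (2 * n + 1)) := by ring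
    _ ≤ 2 * ((1 + κ * R) * Real.exp ((κ * R) ^ 2 / 2) * doubleFactorial (2 * n + 1) /
          (κ * p) ^ (n + 1)) *
          (Real.exp ((κ * R) ^ 2 / 2) * (κ * q) ^ n / doubleFactorial (2 * n + 1)) := by
        gcongr
    _ = _ := by
        rw [hexp, mul_pow κ q, mul_pow κ p, pow_succ κ n]
        field_simp

/-- The integral over ρ < a is a²/(n+3), and over ρ > a it is at most R²/n ≤ 2R²/(n+1). A majorant g
is used because the kernel has a vanishing denominator at ρ = 0 when a = 0; the cases n = 0 and a =
0 take a constant g. -/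
theorem exists_integrable_bound_radial_kernel (n : ℕ) {R a : ℝ} (ha : 0 ≤ a) (haR : a ≤ R) :
    ∃ g : ℝ → ℝ, IntervalIntegrable g volume 0 R ∧
      (∀ ρ ∈ Set.Ioc 0 R, min a ρ ^ n / max a ρ ^ (n + 1) * ρ ^ 2 ≤ g ρ) ∧
      ∫ ρ in (0 : ℝ)..R, g ρ ≤ 3 * R ^ 2 / (n + 1) := by
  have hR : 0 ≤ R := ha.trans haR
  rcases Nat.eq_zero_or_pos n with h0 | hn
  · subst h0
    refine ⟨fun _ => R, intervalIntegrable_const, fun ρ hρ => ?_, ?_⟩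
    · have hm : 0 < max a ρ := hρ.1.trans_le (le_max_right _ _)
      rw [pow_zero, zero_add, pow_one, one_div, inv_mul_eq_div, div_le_iff₀ hm]
      calc ρ ^ 2 = ρ * ρ := sq ρ
        _ ≤ R * max a ρ := mul_le_mul hρ.2 (le_max_right _ _) hρ.1.le hR
    · simp
      nlinarith
  rcases ha.eq_or_lt with ha0 | ha0
  · subst ha0
    refine ⟨fun _ => 0, intervalIntegrable_const, fun ρ hρ => ?_, ?_⟩
    · rw [min_eq_left hρ.1.le, zero_pow hn.ne']
      simp
    · simp
      positivity
  set g : ℝ → ℝ := fun ρ => min a ρ ^ n / max a ρ ^ (n + 1) * ρ ^ 2 with hg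
  have hgc : Continuous g := by
    have : ∀ ρ, max a ρ ^ (n + 1) ≠ 0 := fun ρ => (pow_pos (ha0.trans_le (le_max_left _ _)) _).ne'
    simp only [hg]
    fun_prop (disch := assumption)
  refine ⟨g, hgc.intervalIntegrable _ _, fun ρ _ => le_rfl, ?_⟩
  have hn0 : (0 : ℝ) < n := by exact_mod_cast hn
  have hn1 : (1 : ℝ) ≤ n := by exact_mod_cast hn
  rw [← intervalIntegral.integral_add_adjacent_intervals (hgc.intervalIntegrable 0 a)
    (hgc.intervalIntegrable a R)]
  have h1 : ∫ ρ in (0 : ℝ)..a, g ρ ≤ R ^ 2 / (n + 1) := by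
    have : ∫ ρ in (0 : ℝ)..a, g ρ = ∫ ρ in (0 : ℝ)..a, ρ ^ (n + 2) / a ^ (n + 1) := by
      refine intervalIntegral.integral_congr fun ρ hρ => ?_
      rw [Set.uIcc_of_le ha] at hρ
      simp only [hg]
      rw [min_eq_right hρ.2, max_eq_left hρ.2]
      ring
    rw [this, intervalIntegral.integral_div, integral_pow]
    have h2 : (a ^ (n + 2 + 1) - 0 ^ (n + 2 + 1)) / (((n + 2 : ℕ) : ℝ) + 1) / a ^ (n + 1) =
        a ^ 2 / (n + 3) := by
      rw [zero_pow (by omega)]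
      push_cast
      field_simp
      ring
    rw [h2]
    gcongr
    linarith
  have h2 : ∫ ρ in a..R, g ρ ≤ R ^ 2 / n := by
    have hd : ∀ ρ ∈ Set.uIcc a R,
        HasDerivAt (fun ρ => -(R ^ 2 / n) * (a / ρ) ^ n) (R ^ 2 * (a ^ n / ρ ^ (n + 1))) ρ := by
      intro ρ hρ
      rw [Set.uIcc_of_le haR] at hρ
      have hρ0 : ρ ≠ 0 := (ha0.trans_le hρ.1).ne'
      have := (((hasDerivAt_inv hρ0).const_mul a).pow n).const_mul (-(R ^ 2 / n))
      simp only [← div_eq_mul_inv] at this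
      refine this.congr_deriv ?_
      obtain ⟨k, rfl⟩ : ∃ k, n = k + 1 := ⟨n - 1, by omega⟩
      simp only [Nat.add_sub_cancel, div_pow]
      field_simp
      ring
    have hci : ContinuousOn (fun ρ : ℝ => R ^ 2 * (a ^ n / ρ ^ (n + 1))) (Set.uIcc a R) := by
      intro ρ hρ
      rw [Set.uIcc_of_le haR] at hρ
      have hρ0 : ρ ^ (n + 1) ≠ 0 := (pow_pos (ha0.trans_le hρ.1) _).ne'
      apply ContinuousAt.continuousWithinAt
      fun_prop (disch := assumption)
    have h3 := intervalIntegral.integral_eq_sub_of_hasDerivAt hd hci.intervalIntegrable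
    calc ∫ ρ in a..R, g ρ ≤ ∫ ρ in a..R, R ^ 2 * (a ^ n / ρ ^ (n + 1)) := by
          refine intervalIntegral.integral_mono_on haR (hgc.intervalIntegrable _ _)
            hci.intervalIntegrable fun ρ hρ => ?_
          have hρ0 : 0 < ρ := ha0.trans_le hρ.1
          have : ρ ^ 2 ≤ R ^ 2 := pow_le_pow_left₀ hρ0.le hρ.2 2
          simp only [hg]
          rw [min_eq_left hρ.1, max_eq_right hρ.1, mul_comm]
          gcongr
      _ = R ^ 2 / n * ((a / a) ^ n - (a / R) ^ n) := by rw [h3]; ring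
      _ ≤ R ^ 2 / n * 1 := by
          have : 0 ≤ (a / R) ^ n := by positivity
          rw [div_self ha0.ne', one_pow]
          gcongr
          linarith
      _ = _ := mul_one _
  have h3 : R ^ 2 / n ≤ 2 * R ^ 2 / (n + 1) := by
    rw [div_le_div_iff₀ hn0 (by positivity)]
    nlinarith [sq_nonneg R]
  calc _ ≤ R ^ 2 / (n + 1) + 2 * R ^ 2 / (n + 1) := add_le_add h1 (h2.trans h3)
    _ = _ := by ring

theorem exists_norm_modeOp_le {κ R : ℝ} (hκ : 0 < κ) (hR : 0 < R) :
    ∃ K : ℝ, 0 ≤ K ∧ ∀ (m w : ℝ → ℝ → ℂ) (n : ℕ) (a M : ℝ), 0 ≤ a → 0 ≤ M →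
      (∀ᵐ ρ ∂(volume.restrict (Set.Ioo 0 R)), ‖angularIntegral m n w ρ‖ ≤ M) →
      ‖modeOp κ R m n w a‖ ≤ K * (M / (n + 1)) := by
  set c := 2 * (1 + κ * R) * Real.exp ((κ * R) ^ 2) / κ with hc
  have hc0 : 0 ≤ c := by positivity
  refine ⟨κ ^ 3 * c * (3 * R ^ 2), by positivity, fun m w n a M ha hM hI => ?_⟩
  obtain ⟨g, hgi, hgle, hgint⟩ := exists_integrable_bound_radial_kernel n
    (le_min ha hR.le) (min_le_right a R)
  have hn : (0 : ℝ) < 2 * n + 1 := by positivity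
  have hbound : ‖∫ ρ in (0 : ℝ)..R, sphericalH n (κ * max a ρ) *
      (sphericalJ n (κ * min a ρ) : ℂ) * angularIntegral m n w ρ * (ρ : ℂ) ^ 2‖ ≤
      ∫ ρ in (0 : ℝ)..R, c * M / (2 * n + 1) * g ρ := by
    refine intervalIntegral.norm_integral_le_of_norm_le hR.le ?_ (hgi.const_mul _)
    have hI' : ∀ᵐ ρ ∂volume, ρ ∈ Set.Ioc 0 R → ‖angularIntegral m n w ρ‖ ≤ M := by
      rw [← ae_restrict_iff' measurableSet_Ioc, ← restrict_Ioo_eq_restrict_Ioc]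
      exact hI
    filter_upwards [hI'] with ρ hρ hmem
    have h1 := norm_sphericalH_mul_sphericalJ_le n hκ hmem.1 hmem.2 ha
    have h2 := hgle ρ hmem
    have h3 := hρ hmem
    have hρn : ‖(ρ : ℂ)‖ = ρ := by rw [Complex.norm_real, Real.norm_eq_abs, abs_of_pos hmem.1]
    rw [norm_mul, norm_mul, norm_mul, norm_pow, hρn]
    set p := ‖sphericalH n (κ * max a ρ)‖ * ‖(sphericalJ n (κ * min a ρ) : ℂ)‖ with hp
    have hp0 : 0 ≤ p := by positivity
    rw [← mul_div_right_comm, le_div_iff₀ hn]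
    calc p * ‖angularIntegral m n w ρ‖ * ρ ^ 2 * (2 * n + 1)
        ≤ p * M * ρ ^ 2 * (2 * n + 1) := by gcongr
      _ = ((2 * n + 1) * p) * (M * ρ ^ 2) := by ring
      _ ≤ (c * (min (min a R) ρ ^ n / max (min a R) ρ ^ (n + 1))) * (M * ρ ^ 2) := by gcongr
      _ = c * M * (min (min a R) ρ ^ n / max (min a R) ρ ^ (n + 1) * ρ ^ 2) := by ring
      _ ≤ c * M * g ρ := by gcongr
  rw [intervalIntegral.integral_const_mul] at hbound
  have hpre : ‖-((2 * (n : ℂ) + 1) * (κ : ℂ) ^ 3)‖ = (2 * n + 1) * κ ^ 3 := by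
    rw [norm_neg, norm_mul, norm_pow, Complex.norm_real, Real.norm_eq_abs, abs_of_pos hκ]
    congr 1
    have : (2 * (n : ℂ) + 1) = ((2 * n + 1 : ℝ) : ℂ) := by push_cast; ring
    rw [this, Complex.norm_real, Real.norm_eq_abs, abs_of_pos hn]
  rw [modeOp, norm_mul, hpre]
  calc _ ≤ (2 * n + 1) * κ ^ 3 * (c * M / (2 * n + 1) * (3 * R ^ 2 / (n + 1))) := by
        refine mul_le_mul_of_nonneg_left (hbound.trans ?_) (by positivity)
        exact mul_le_mul_of_nonneg_left hgint (by positivity)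
    _ = _ := by field_simp

end Kernel

/-! ### Legendre expansion of the tail and triple products -/

section Expansion
open Polynomial

theorem integral_legendreP_mul_legendreP (n l : ℕ) :
    ∫ t in (-1 : ℝ)..1, (((legendreP n).eval t : ℝ) : ℂ) * (((legendreP l).eval t : ℝ) : ℂ) =
      if n = l then 2 / (2 * (l : ℂ) + 1) else 0 := by
  simp only [← Complex.ofReal_mul]
  rw [intervalIntegral.integral_ofReal]
  split_ifs with h
  · rw [h, integral_legendreP_sq]
    push_cast
    rfl
  · rw [integral_legendreP_mul_of_ne h, Complex.ofReal_zero]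

theorem IntervalIntegrable.mul_eval_ofReal {f : ℝ → ℂ}
    (hf : IntervalIntegrable f volume (-1) 1) (p : ℝ[X]) :
    IntervalIntegrable (fun t => f t * ((p.eval t : ℝ) : ℂ)) volume (-1) 1 :=
  hf.mul_continuousOn (Complex.continuous_ofReal.comp p.continuous).continuousOn

theorem two_mul_natCast_add_one_ne_zero (n : ℕ) : (2 * (n : ℂ) + 1) ≠ 0 := by
  exact_mod_cast (by omega : 2 * n + 1 ≠ 0)

theorem integral_mul_legendreP_eq (f : ℝ → ℝ → ℂ) (n : ℕ) (ρ : ℝ) :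
    ∫ t in (-1 : ℝ)..1, f ρ t * (((legendreP n).eval t : ℝ) : ℂ) =
      2 / (2 * (n : ℂ) + 1) * legendreCoeff f n ρ := by
  have := two_mul_natCast_add_one_ne_zero n
  rw [legendreCoeff]
  field_simp

theorem integral_mul_eval_eq_zero {f : ℝ → ℂ} (hf : IntervalIntegrable f volume (-1) 1)
    (h : ∀ n, ∫ t in (-1 : ℝ)..1, f t * (((legendreP n).eval t : ℝ) : ℂ) = 0) (p : ℝ[X]) :
    ∫ t in (-1 : ℝ)..1, f t * ((p.eval t : ℝ) : ℂ) = 0 := by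
  obtain ⟨a, ha⟩ := exists_eq_sum_legendreP (p.natDegree + 1) p (Nat.lt_succ_self _)
  have : ∀ t, f t * ((p.eval t : ℝ) : ℂ) = ∑ l ∈ Finset.range (p.natDegree + 1),
      (a l : ℂ) * (f t * (((legendreP l).eval t : ℝ) : ℂ)) := by
    intro t
    conv_lhs => rw [ha]
    simp only [eval_finsetSum, eval_mul, eval_C, Complex.ofReal_sum, Complex.ofReal_mul,
      Finset.mul_sum]
    exact Finset.sum_congr rfl fun _ _ => by ring
  simp only [this]
  rw [intervalIntegral.integral_finsetSum fun l _ => (hf.mul_eval_ofReal _).const_mul _]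
  simp [h]

/-- Completeness of the Legendre system in L¹: f annihilates all polynomials, hence by Weierstrass
approximation every continuous test function. -/
theorem ae_eq_zero_of_integral_mul_legendreP_eq_zero {f : ℝ → ℂ}
    (hf : IntervalIntegrable f volume (-1) 1)
    (h : ∀ n, ∫ t in (-1 : ℝ)..1, f t * (((legendreP n).eval t : ℝ) : ℂ) = 0) :
    ∀ᵐ t ∂volume, t ∈ Set.Ioo (-1 : ℝ) 1 → f t = 0 := by
  have hle : (-1 : ℝ) ≤ 1 := by norm_num
  have hfi : IntegrableOn f (Set.Ioo (-1) 1) := by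
    have := (intervalIntegrable_iff_integrableOn_Ioc_of_le hle).mp hf
    exact this.mono_set Set.Ioo_subset_Ioc_self
  refine isOpen_Ioo.ae_eq_zero_of_integral_contDiff_smul_eq_zero hfi.locallyIntegrableOn
    fun g hg _ hgs => ?_
  have h1 : ∫ t, g t • f t = ∫ t in (-1 : ℝ)..1, f t * ((g t : ℝ) : ℂ) := by
    rw [intervalIntegral.integral_of_le hle]
    rw [setIntegral_eq_integral_of_forall_compl_eq_zero]
    · exact integral_congr_ae (Filter.Eventually.of_forall fun t => by
        simp [Complex.real_smul, mul_comm])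
    · intro t ht
      have : t ∉ tsupport g := fun h => ht (Set.Ioo_subset_Ioc_self (hgs h))
      rw [image_eq_zero_of_notMem_tsupport this]
      simp
  rw [h1]
  have hbound : ∀ ε : ℝ, 0 < ε → ‖∫ t in (-1 : ℝ)..1, f t * ((g t : ℝ) : ℂ)‖ ≤
      ε * ∫ t in (-1 : ℝ)..1, ‖f t‖ := by
    intro ε hε
    obtain ⟨p, hp⟩ := exists_polynomial_near_of_continuousOn (-1) 1 g hg.continuous.continuousOn
      ε hε
    have hgi : IntervalIntegrable (fun t => f t * ((g t : ℝ) : ℂ)) volume (-1) 1 :=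
      hf.mul_continuousOn (Complex.continuous_ofReal.comp hg.continuous).continuousOn
    have h2 : ∫ t in (-1 : ℝ)..1, f t * ((g t : ℝ) : ℂ) =
        ∫ t in (-1 : ℝ)..1, (f t * ((g t : ℝ) : ℂ) - f t * ((p.eval t : ℝ) : ℂ)) := by
      rw [intervalIntegral.integral_sub hgi (hf.mul_eval_ofReal p),
        integral_mul_eval_eq_zero hf h p, sub_zero]
    rw [h2, ← intervalIntegral.integral_const_mul]
    refine intervalIntegral.norm_integral_le_of_norm_le hle ?_ (hf.norm.const_mul ε)
    refine Filter.Eventually.of_forall fun t ht => ?_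
    rw [← mul_sub, ← Complex.ofReal_sub, norm_mul, Complex.norm_real, Real.norm_eq_abs, abs_sub_comm,
      mul_comm]
    exact mul_le_mul_of_nonneg_right (hp t (Set.Ioc_subset_Icc_self ht)).le (norm_nonneg _)
  set J := ∫ t in (-1 : ℝ)..1, ‖f t‖ with hJ
  have hJ0 : 0 ≤ J := intervalIntegral.integral_nonneg hle fun _ _ => norm_nonneg _
  rw [← norm_le_zero_iff]
  refine le_of_forall_pos_le_add fun δ hδ => ?_
  refine (hbound (δ / (J + 1)) (by positivity)).trans ?_
  rw [zero_add, div_mul_eq_mul_div, div_le_iff₀ (by positivity)]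
  nlinarith

theorem hasSum_integral_legendre_series {c : ℕ → ℂ} {b : ℕ → ℝ} (hb : Summable b)
    (hcb : ∀ s, ‖c s‖ ≤ b s) {h : ℝ → ℂ} (hh : IntervalIntegrable h volume (-1) 1) :
    HasSum (fun s => c s * ∫ t in (-1 : ℝ)..1, h t * (((legendreP s).eval t : ℝ) : ℂ))
      (∫ t in (-1 : ℝ)..1, (∑' s, c s * (((legendreP s).eval t : ℝ) : ℂ)) * h t) := by
  have hle : (-1 : ℝ) ≤ 1 := by norm_num
  have hP : ∀ s : ℕ, ∀ t ∈ Set.uIoc (-1 : ℝ) 1, ‖c s * (((legendreP s).eval t : ℝ) : ℂ)‖ ≤ b s := by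
    intro s t ht
    rw [Set.uIoc_of_le hle] at ht
    have := abs_eval_legendreP_le_one s (Set.Ioc_subset_Icc_self ht)
    rw [norm_mul, Complex.norm_real, Real.norm_eq_abs]
    calc _ ≤ ‖c s‖ * 1 := by gcongr
      _ ≤ b s := by rw [mul_one]; exact hcb s
  have key := intervalIntegral.hasSum_integral_of_dominated_convergence
    (F := fun s t => c s * (h t * (((legendreP s).eval t : ℝ) : ℂ)))
    (f := fun t => (∑' s, c s * (((legendreP s).eval t : ℝ) : ℂ)) * h t)
    (a := -1) (b := 1) (μ := volume) (fun s t => b s * ‖h t‖) ?_ ?_ ?_ ?_ ?_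
  · simpa only [intervalIntegral.integral_const_mul] using key
  · intro s
    exact (((hh.mul_eval_ofReal (legendreP s)).const_mul (c s)).def').aestronglyMeasurable
  · intro s
    refine Filter.Eventually.of_forall fun t ht => ?_
    rw [mul_left_comm, norm_mul, mul_comm]
    exact mul_le_mul_of_nonneg_right (hP s t ht) (norm_nonneg _)
  · exact Filter.Eventually.of_forall fun t _ => hb.mul_right _
  · simp only [tsum_mul_right]
    exact hh.norm.const_mul _
  · refine Filter.Eventually.of_forall fun t ht => ?_
    have := (Summable.of_norm_bounded hb fun s => hP s t ht).hasSum.mul_right (h t)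
    simpa only [mul_assoc, mul_comm (h t)] using this

/-- As u is merely integrable, its Legendre series is not known to represent it. The summable
coefficient bound gives a continuous sum v on [-1, 1] with the same Legendre coefficients as the
tail, so the two agree almost everywhere and the series may be integrated termwise against m P_n. -/
theorem hasSum_angularIntegral_legendreTail {m u : ℝ → ℝ → ℂ} {ρ : ℝ}
    (hm : IntervalIntegrable (m ρ) volume (-1) 1) (hu : IntervalIntegrable (u ρ) volume (-1) 1)
    {F : ℕ} {b : ℕ → ℝ} (hb0 : ∀ s, 0 ≤ b s) (hb : Summable b)
    (hub : ∀ s, F < s → ‖legendreCoeff u s ρ‖ ≤ b s) (n : ℕ) :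
    HasSum (fun s => (if s ≤ F then 0 else legendreCoeff u s ρ) *
      ∫ t in (-1 : ℝ)..1, m ρ t * (((legendreP n).eval t : ℝ) : ℂ) *
        (((legendreP s).eval t : ℝ) : ℂ))
      (angularIntegral m n (legendreTail F u) ρ) := by
  have hle : (-1 : ℝ) ≤ 1 := by norm_num
  set c : ℕ → ℂ := fun s => if s ≤ F then 0 else legendreCoeff u s ρ with hc
  have hcb : ∀ s, ‖c s‖ ≤ b s := by
    intro s
    simp only [hc]
    split_ifs with h
    · simpa using hb0 s
    · exact hub s (not_le.mp h)
  set v : ℝ → ℂ := fun t => ∑' s, c s * (((legendreP s).eval t : ℝ) : ℂ) with hv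
  have hvi : IntervalIntegrable v volume (-1) 1 := by
    apply ContinuousOn.intervalIntegrable
    rw [Set.uIcc_of_le hle]
    refine continuousOn_tsum (fun s => ?_) hb fun s t ht => ?_
    · exact (continuous_const.mul
        (Complex.continuous_ofReal.comp (legendreP s).continuous)).continuousOn
    · have := abs_eval_legendreP_le_one s ht
      rw [norm_mul, Complex.norm_real, Real.norm_eq_abs]
      calc _ ≤ ‖c s‖ * 1 := by gcongr
        _ ≤ b s := by rw [mul_one]; exact hcb s
  have hPi : ∀ l : ℕ, IntervalIntegrable (fun t => (((legendreP l).eval t : ℝ) : ℂ)) volume (-1) 1 :=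
    fun l => (Complex.continuous_ofReal.comp (legendreP l).continuous).intervalIntegrable _ _
  have hvc : ∀ l : ℕ, ∫ t in (-1 : ℝ)..1, v t * (((legendreP l).eval t : ℝ) : ℂ) =
      2 / (2 * (l : ℂ) + 1) * c l := by
    intro l
    have h1 := hasSum_integral_legendre_series hb hcb (hPi l)
    refine h1.unique ?_
    simp only [integral_legendreP_mul_legendreP]
    have := hasSum_single (f := fun s => c s * if l = s then 2 / (2 * (s : ℂ) + 1) else 0) l
      fun s hs => by simp [hs.symm]
    simpa only [if_true, mul_comm (c l)] using this
  have htr : ∀ l : ℕ, ∫ t in (-1 : ℝ)..1, legendreTrunc F u ρ t * (((legendreP l).eval t : ℝ) : ℂ) =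
      2 / (2 * (l : ℂ) + 1) * (if l ≤ F then legendreCoeff u l ρ else 0) := by
    intro l
    simp only [legendreTrunc, Finset.sum_mul, mul_assoc]
    rw [intervalIntegral.integral_finsetSum fun s _ =>
      ((hPi s).mul_eval_ofReal (legendreP l)).const_mul _]
    simp only [intervalIntegral.integral_const_mul, integral_legendreP_mul_legendreP, mul_ite,
      mul_zero, Finset.sum_ite_eq', Finset.mem_range, Nat.lt_succ_iff]
    split_ifs <;> ring
  have htri : IntervalIntegrable (legendreTrunc F u ρ) volume (-1) 1 := by
    apply Continuous.intervalIntegrable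
    unfold legendreTrunc
    exact continuous_finsetSum _ fun s _ => continuous_const.mul
      (Complex.continuous_ofReal.comp (legendreP s).continuous)
  have hti : IntervalIntegrable (legendreTail F u ρ) volume (-1) 1 := hu.sub htri
  have hae : ∀ᵐ t ∂volume, t ∈ Set.Ioo (-1 : ℝ) 1 → legendreTail F u ρ t - v t = 0 := by
    refine ae_eq_zero_of_integral_mul_legendreP_eq_zero (hti.sub hvi) fun l => ?_
    simp only [sub_mul, legendreTail]
    rw [intervalIntegral.integral_sub, intervalIntegral.integral_sub, hvc, htr,
      integral_mul_legendreP_eq]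
    · simp only [hc]
      split_ifs <;> ring
    · exact hu.mul_eval_ofReal _
    · exact htri.mul_eval_ofReal _
    · simpa only [sub_mul, legendreTail] using hti.mul_eval_ofReal (legendreP l)
    · exact hvi.mul_eval_ofReal _
  have hI : angularIntegral m n (legendreTail F u) ρ =
      ∫ t in (-1 : ℝ)..1, v t * (m ρ t * (((legendreP n).eval t : ℝ) : ℂ)) := by
    rw [angularIntegral, intervalIntegral.integral_of_le hle, intervalIntegral.integral_of_le hle,
      ← restrict_Ioo_eq_restrict_Ioc]
    refine setIntegral_congr_ae measurableSet_Ioo ?_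
    filter_upwards [hae] with t ht hmem
    rw [sub_eq_zero.mp (ht hmem), mul_assoc]
  rw [hI]
  exact hasSum_integral_legendre_series hb hcb (hm.mul_eval_ofReal (legendreP n))

/-- Expand P_n P_s = ∑ a_l P_l. Orthogonality confines l to [s - n, s + n], Parseval with |P_n| ≤ 1
gives ∑ a_l² · 2/(2l+1) ≤ ‖P_s‖², and Cauchy–Schwarz against the coefficients of m concludes. No
explicit linearisation coefficients are needed. -/
theorem norm_integral_mul_legendreP_mul_legendreP_le {m : ℝ → ℝ → ℂ} {ρ : ℝ}
    (hm : IntervalIntegrable (m ρ) volume (-1) 1) (n s : ℕ) :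
    ‖∫ t in (-1 : ℝ)..1, m ρ t * (((legendreP n).eval t : ℝ) : ℂ) *
        (((legendreP s).eval t : ℝ) : ℂ)‖ ≤
      √(∑ l ∈ Finset.Ico (s - n) (n + s + 1), ‖legendreCoeff m l ρ‖ ^ 2 * (2 / (2 * l + 1))) *
        √(2 / (2 * s + 1)) := by
  have hle : (-1 : ℝ) ≤ 1 := by norm_num
  set Q := legendreP n * legendreP s with hQ
  have hdeg : Q.natDegree < n + s + 1 := by
    have := natDegree_mul_le (p := legendreP n) (q := legendreP s)
    rw [← hQ, natDegree_legendreP, natDegree_legendreP] at this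
    omega
  obtain ⟨a, ha⟩ := exists_eq_sum_legendreP _ Q hdeg
  have hcoef : ∀ l < n + s + 1, ∫ t in (-1 : ℝ)..1, Q.eval t * (legendreP l).eval t =
      a l * (2 / (2 * l + 1)) := by
    intro l hl
    conv_lhs => rw [ha]
    rw [integral_sum_legendreP_mul, if_pos hl, integral_legendreP_sq]
  -- Regroup the triple product: P_n P_l has degree below s, so it is orthogonal to P_s.
  have ha0 : ∀ l < s - n, a l = 0 := by
    intro l hl
    have h1 := hcoef l (by omega)
    have h2 : ∫ t in (-1 : ℝ)..1, Q.eval t * (legendreP l).eval t = 0 := by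
      have h3 : (legendreP n * legendreP l).natDegree < s := by
        have := natDegree_mul_le (p := legendreP n) (q := legendreP l)
        rw [natDegree_legendreP, natDegree_legendreP] at this
        omega
      rw [← integral_mul_legendreP_of_natDegree_lt h3]
      refine intervalIntegral.integral_congr fun t _ => ?_
      simp only [hQ, eval_mul]
      ring
    rw [h2] at h1
    have h3 : (2 / (2 * (l : ℝ) + 1)) ≠ 0 := by positivity
    exact (mul_eq_zero.mp h1.symm).resolve_right h3
  have hsub : Finset.Ico (s - n) (n + s + 1) ⊆ Finset.range (n + s + 1) := by
    intro l hl
    simp only [Finset.mem_Ico, Finset.mem_range] at hl ⊢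
    exact hl.2
  have hsum : Q = ∑ l ∈ Finset.Ico (s - n) (n + s + 1), C (a l) * legendreP l := by
    rw [Finset.sum_subset hsub]
    · exact ha
    · intro l hl hl'
      simp only [Finset.mem_Ico, Finset.mem_range] at hl hl'
      rw [ha0 l (by omega), C_0, zero_mul]
  have hnorm : ∑ l ∈ Finset.Ico (s - n) (n + s + 1), a l ^ 2 * (2 / (2 * (l : ℝ) + 1)) ≤
      2 / (2 * (s : ℝ) + 1) := by
    have h1 : ∫ t in (-1 : ℝ)..1, Q.eval t * Q.eval t =
        ∑ l ∈ Finset.Ico (s - n) (n + s + 1), a l ^ 2 * (2 / (2 * (l : ℝ) + 1)) := by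
      have h2 : ∀ t : ℝ, Q.eval t * Q.eval t = ∑ l ∈ Finset.Ico (s - n) (n + s + 1),
          a l * (Q.eval t * (legendreP l).eval t) := by
        intro t
        have h3 := congrArg (eval t) hsum
        rw [eval_finsetSum] at h3
        nth_rewrite 1 [h3]
        rw [Finset.sum_mul]
        refine Finset.sum_congr rfl fun l _ => ?_
        rw [eval_mul, eval_C]
        ring
      simp only [h2]
      rw [intervalIntegral.integral_finsetSum]
      · refine Finset.sum_congr rfl fun l hl => ?_
        rw [intervalIntegral.integral_const_mul, hcoef l (Finset.mem_Ico.mp hl).2]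
        ring
      · intro l _
        exact Continuous.intervalIntegrable (by fun_prop) _ _
    rw [← h1, ← integral_legendreP_sq s]
    refine intervalIntegral.integral_mono_on hle (Continuous.intervalIntegrable (by fun_prop) _ _)
      (Continuous.intervalIntegrable (by fun_prop) _ _) fun t ht => ?_
    have h2 := abs_le_one_iff_mul_self_le_one.mp (abs_eval_legendreP_le_one n ht)
    simp only [hQ, eval_mul]
    nlinarith [mul_self_nonneg ((legendreP s).eval t)]
  have hint : ∫ t in (-1 : ℝ)..1, m ρ t * (((legendreP n).eval t : ℝ) : ℂ) *
        (((legendreP s).eval t : ℝ) : ℂ) = ∑ l ∈ Finset.Ico (s - n) (n + s + 1),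
        (a l : ℂ) * (2 / (2 * (l : ℂ) + 1) * legendreCoeff m l ρ) := by
    have h2 : ∀ t : ℝ, m ρ t * (((legendreP n).eval t : ℝ) : ℂ) *
        (((legendreP s).eval t : ℝ) : ℂ) = ∑ l ∈ Finset.Ico (s - n) (n + s + 1),
          (a l : ℂ) * (m ρ t * (((legendreP l).eval t : ℝ) : ℂ)) := by
      intro t
      rw [mul_assoc, ← Complex.ofReal_mul, ← eval_mul, ← hQ, hsum, eval_finsetSum,
        Complex.ofReal_sum, Finset.mul_sum]
      refine Finset.sum_congr rfl fun l _ => ?_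
      rw [eval_mul, eval_C, Complex.ofReal_mul]
      ring
    simp only [h2]
    rw [intervalIntegral.integral_finsetSum fun l _ => (hm.mul_eval_ofReal _).const_mul _]
    simp only [intervalIntegral.integral_const_mul, integral_mul_legendreP_eq]
  have hw : ∀ l : ℕ, √(2 / (2 * (l : ℝ) + 1)) * √(2 / (2 * (l : ℝ) + 1)) = 2 / (2 * (l : ℝ) + 1) :=
    fun l => Real.mul_self_sqrt (by positivity)
  have hpos : ∀ l : ℕ, 0 ≤ 2 / (2 * (l : ℝ) + 1) := fun l => by positivity
  rw [hint]
  calc _ ≤ ∑ l ∈ Finset.Ico (s - n) (n + s + 1),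
        (‖legendreCoeff m l ρ‖ * √(2 / (2 * (l : ℝ) + 1))) * (|a l| * √(2 / (2 * (l : ℝ) + 1))) := by
        refine norm_sum_le_of_le _ fun l _ => le_of_eq ?_
        have h2 : (2 / (2 * (l : ℂ) + 1)) = ((2 / (2 * (l : ℝ) + 1) : ℝ) : ℂ) := by push_cast; rfl
        rw [h2, norm_mul, norm_mul, Complex.norm_real, Complex.norm_real, Real.norm_eq_abs,
          Real.norm_eq_abs, abs_of_nonneg (hpos l)]
        linear_combination -(‖legendreCoeff m l ρ‖ * |a l|) * hw l
    _ ≤ √(∑ l ∈ Finset.Ico (s - n) (n + s + 1),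
          (‖legendreCoeff m l ρ‖ * √(2 / (2 * (l : ℝ) + 1))) ^ 2) *
        √(∑ l ∈ Finset.Ico (s - n) (n + s + 1), (|a l| * √(2 / (2 * (l : ℝ) + 1))) ^ 2) :=
        Real.sum_mul_le_sqrt_mul_sqrt _ _ _
    _ ≤ _ := by
        simp only [mul_pow, sq_abs, Real.sq_sqrt (hpos _)]
        gcongr

end Expansion

/-! ### Summation of the estimates over l, s and n -/

section Estimates

theorem summable_natCast_rpow_neg {p : ℝ} (hp : 1 < p) : Summable fun n : ℕ => (n : ℝ) ^ (-p) :=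
  Real.summable_nat_rpow.mpr (by linarith)

theorem tsum_natCast_rpow_nonneg (p : ℝ) : 0 ≤ ∑' n : ℕ, (n : ℝ) ^ p :=
  tsum_nonneg fun _ => by positivity

theorem sum_harmonic_mul_rpow_le {α : ℝ} (hα0 : 0 < α) (hα1 : α < 1) {F : ℕ} (hF : 1 ≤ F) :
    ∑ n ∈ Finset.range (F + 1), (((F - n : ℕ) : ℝ) + 1) ^ (-α) / ((n : ℝ) + 1) ≤
      4 * (∑' n : ℕ, (n : ℝ) ^ (-(5 / 4) : ℝ)) * (F : ℝ) ^ (1 / 4 - α) := by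
  set Z := ∑' n : ℕ, (n : ℝ) ^ (-(5 / 4) : ℝ) with hZ
  have hZ0 : 0 ≤ Z := tsum_natCast_rpow_nonneg _
  have hF0 : (0 : ℝ) < F := by exact_mod_cast hF
  have hF1 : (0 : ℝ) < F + 1 := by positivity
  -- With D = F - n + 1, write D^{-α} = D^{1-α}/D ≤ (F+1)^{1-α}/D and split 1/((n+1)D) by partial
  -- fractions, using (n+1) + D = F + 2. Two harmonic sums remain, equal by reflection.
  have hterm : ∀ n ∈ Finset.range (F + 1), (((F - n : ℕ) : ℝ) + 1) ^ (-α) / ((n : ℝ) + 1) ≤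
      ((F : ℝ) + 1) ^ (-α) * (1 / ((n : ℝ) + 1) + 1 / (((F - n : ℕ) : ℝ) + 1)) := by
    intro n hn
    have hnF : n ≤ F := Nat.lt_succ_iff.mp (Finset.mem_range.mp hn)
    have hn0 : (0 : ℝ) ≤ n := by positivity
    rw [Nat.cast_sub hnF]
    have hD : (1 : ℝ) ≤ (F : ℝ) - n + 1 := by
      have : (n : ℝ) ≤ F := by exact_mod_cast hnF
      linarith
    set D := (F : ℝ) - n + 1 with hDdef
    have hD0 : 0 < D := by linarith
    have h1 : D ^ (-α) = D ^ (1 - α) / D := by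
      rw [← Real.rpow_sub_one hD0.ne']; congr 1; ring
    have h2 : D ^ (1 - α) ≤ ((F : ℝ) + 1) ^ (1 - α) :=
      Real.rpow_le_rpow hD0.le (by linarith) (by linarith)
    have h3 : ((F : ℝ) + 1) ^ (1 - α) = ((F : ℝ) + 1) ^ (-α) * (F + 1) := by
      rw [← Real.rpow_add_one hF1.ne']; congr 1; ring
    have h4 : 1 / ((n : ℝ) + 1) + 1 / D = (F + 2) / (D * (n + 1)) := by
      field_simp
      rw [hDdef]; ring
    rw [h1, h4, div_div, mul_div_assoc']
    refine div_le_div_of_nonneg_right ?_ (by positivity)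
    refine h2.trans ?_
    rw [h3]
    exact mul_le_mul_of_nonneg_left (by linarith) (by positivity)
  have hharm : ∑ n ∈ Finset.range (F + 1), 1 / ((n : ℝ) + 1) ≤ ((F : ℝ) + 1) ^ (1 / 4 : ℝ) * Z := by
    have h1 : ∀ n ∈ Finset.range (F + 1), 1 / ((n : ℝ) + 1) ≤
        ((F : ℝ) + 1) ^ (1 / 4 : ℝ) * ((n + 1 : ℕ) : ℝ) ^ (-(5 / 4) : ℝ) := by
      intro n hn
      have hnF : (n : ℝ) ≤ F := by exact_mod_cast Nat.lt_succ_iff.mp (Finset.mem_range.mp hn)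
      have hn0 : (0 : ℝ) < (n : ℝ) + 1 := by positivity
      have h2 : 1 / ((n : ℝ) + 1) = ((n : ℝ) + 1) ^ (1 / 4 : ℝ) * ((n : ℝ) + 1) ^ (-(5 / 4) : ℝ) := by
        rw [← Real.rpow_add hn0, one_div, ← Real.rpow_neg_one]
        norm_num
      rw [h2]
      push_cast
      gcongr
    refine (Finset.sum_le_sum h1).trans ?_
    rw [← Finset.mul_sum]
    refine mul_le_mul_of_nonneg_left ?_ (by positivity)
    have hs := summable_natCast_rpow_neg (p := 5 / 4) (by norm_num)
    have h3 := (hs.sum_le_tsum (Finset.range (F + 2)) fun n _ => by positivity)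
    rw [Finset.sum_range_succ'] at h3
    have : (0 : ℝ) ≤ ((0 : ℕ) : ℝ) ^ (-(5 / 4) : ℝ) := by positivity
    linarith
  have hflip : ∑ n ∈ Finset.range (F + 1), 1 / (((F - n : ℕ) : ℝ) + 1) =
      ∑ n ∈ Finset.range (F + 1), 1 / ((n : ℝ) + 1) :=
    Finset.sum_flip fun n : ℕ => 1 / ((n : ℝ) + 1)
  calc _ ≤ ∑ n ∈ Finset.range (F + 1),
        ((F : ℝ) + 1) ^ (-α) * (1 / ((n : ℝ) + 1) + 1 / (((F - n : ℕ) : ℝ) + 1)) :=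
        Finset.sum_le_sum hterm
    _ = ((F : ℝ) + 1) ^ (-α) * (2 * ∑ n ∈ Finset.range (F + 1), 1 / ((n : ℝ) + 1)) := by
        rw [← Finset.mul_sum, Finset.sum_add_distrib, hflip, two_mul]
    _ ≤ (F : ℝ) ^ (-α) * (2 * (2 * (F : ℝ) ^ (1 / 4 : ℝ) * Z)) := by
        have h1 : ((F : ℝ) + 1) ^ (-α) ≤ (F : ℝ) ^ (-α) :=
          Real.rpow_le_rpow_of_nonpos hF0 (by linarith) (by linarith)
        have h2 : ((F : ℝ) + 1) ^ (1 / 4 : ℝ) ≤ 2 * (F : ℝ) ^ (1 / 4 : ℝ) := by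
          have h3 : ((F : ℝ) + 1) ≤ 2 * F := by
            have : (1 : ℝ) ≤ F := by exact_mod_cast hF
            linarith
          have h4 : (2 : ℝ) ^ (1 / 4 : ℝ) ≤ 2 :=
            (Real.rpow_le_rpow_of_exponent_le one_le_two (by norm_num)).trans (Real.rpow_one 2).le
          calc ((F : ℝ) + 1) ^ (1 / 4 : ℝ) ≤ (2 * F) ^ (1 / 4 : ℝ) := by gcongr
            _ = 2 ^ (1 / 4 : ℝ) * (F : ℝ) ^ (1 / 4 : ℝ) := Real.mul_rpow zero_le_two hF0.le
            _ ≤ _ := by gcongr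
        have h5 := hharm.trans (mul_le_mul_of_nonneg_right h2 hZ0)
        have h6 : 0 ≤ ∑ n ∈ Finset.range (F + 1), 1 / ((n : ℝ) + 1) :=
          Finset.sum_nonneg fun _ _ => by positivity
        gcongr
    _ = _ := by
        rw [sub_eq_add_neg, Real.rpow_add hF0]
        ring

theorem norm_integral_mul_legendreP_mul_legendreP_le_rpow {m : ℝ → ℝ → ℂ} {ρ A β : ℝ}
    (hm : IntervalIntegrable (m ρ) volume (-1) 1) (hA : 0 ≤ A) (hβ : 0 ≤ β)
    (hmA : ∀ l : ℕ, 1 ≤ l → ‖legendreCoeff m l ρ‖ ≤ A * (l : ℝ) ^ (-β)) {n s : ℕ} (hns : n < s) :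
    ‖∫ t in (-1 : ℝ)..1, m ρ t * (((legendreP n).eval t : ℝ) : ℂ) *
        (((legendreP s).eval t : ℝ) : ℂ)‖ ≤
      2 * A * √(∑' n : ℕ, (n : ℝ) ^ (-(5 / 4) : ℝ)) * ((s - n : ℕ) : ℝ) ^ (-β) *
        (s : ℝ) ^ (-(3 / 8) : ℝ) := by
  set Z := ∑' n : ℕ, (n : ℝ) ^ (-(5 / 4) : ℝ) with hZ
  have hZ0 : 0 ≤ Z := tsum_natCast_rpow_nonneg _
  set d : ℝ := ((s - n : ℕ) : ℝ) with hd
  have hd0 : 0 < d := by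
    rw [hd]; exact_mod_cast Nat.sub_pos_of_lt hns
  have hs0 : (0 : ℝ) < s := by exact_mod_cast (Nat.zero_le n).trans_lt hns
  have hterm : ∀ l ∈ Finset.Ico (s - n) (n + s + 1),
      ‖legendreCoeff m l ρ‖ ^ 2 * (2 / (2 * l + 1)) ≤
        (A * d ^ (-β)) ^ 2 * (2 * s) ^ (1 / 4 : ℝ) * (l : ℝ) ^ (-(5 / 4) : ℝ) := by
    intro l hl
    rw [Finset.mem_Ico] at hl
    have hl1 : 1 ≤ l := by omega
    have hl0 : (0 : ℝ) < l := by exact_mod_cast hl1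
    have hdl : d ≤ l := by rw [hd]; exact_mod_cast hl.1
    have hls : (l : ℝ) ≤ 2 * s := by exact_mod_cast (by omega : l ≤ 2 * s)
    have h1 : ‖legendreCoeff m l ρ‖ ≤ A * d ^ (-β) :=
      (hmA l hl1).trans (mul_le_mul_of_nonneg_left
        (Real.rpow_le_rpow_of_nonpos hd0 hdl (by linarith)) hA)
    -- The weight is about 1/l; giving up l^{1/4} ≤ (2s)^{1/4} makes it summable. After the square
    -- root this costs s^{1/8}, turning s^{-1/2} into s^{-3/8}.
    have h2 : 2 / (2 * (l : ℝ) + 1) ≤ (2 * s) ^ (1 / 4 : ℝ) * (l : ℝ) ^ (-(5 / 4) : ℝ) := by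
      calc 2 / (2 * (l : ℝ) + 1) ≤ (l : ℝ)⁻¹ := by
            rw [inv_eq_one_div, div_le_div_iff₀ (by positivity) hl0]; linarith
        _ = (l : ℝ) ^ (1 / 4 : ℝ) * (l : ℝ) ^ (-(5 / 4) : ℝ) := by
            rw [← Real.rpow_add hl0, ← Real.rpow_neg_one]; norm_num
        _ ≤ _ := by gcongr
    rw [mul_assoc]
    exact mul_le_mul (pow_le_pow_left₀ (norm_nonneg _) h1 2) h2 (by positivity) (by positivity)
  have hsum : ∑ l ∈ Finset.Ico (s - n) (n + s + 1), ‖legendreCoeff m l ρ‖ ^ 2 * (2 / (2 * (l : ℝ) + 1)) ≤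
      (A * d ^ (-β)) ^ 2 * (2 * s) ^ (1 / 4 : ℝ) * Z := by
    refine (Finset.sum_le_sum hterm).trans ?_
    rw [← Finset.mul_sum]
    exact mul_le_mul_of_nonneg_left ((summable_natCast_rpow_neg (by norm_num)).sum_le_tsum _
      fun _ _ => by positivity) (by positivity)
  have hsq : √((A * d ^ (-β)) ^ 2 * (2 * s) ^ (1 / 4 : ℝ) * Z) ≤
      A * d ^ (-β) * (2 * (s : ℝ) ^ (1 / 8 : ℝ)) * √Z := by
    rw [Real.sqrt_mul' _ hZ0, Real.sqrt_mul (by positivity), Real.sqrt_sq (by positivity)]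
    have h1 : √((2 * (s : ℝ)) ^ (1 / 4 : ℝ)) ≤ 2 * (s : ℝ) ^ (1 / 8 : ℝ) := by
      rw [Real.sqrt_eq_rpow, ← Real.rpow_mul (by positivity), Real.mul_rpow zero_le_two hs0.le]
      have h4 : (2 : ℝ) ^ (1 / 8 : ℝ) ≤ 2 :=
        (Real.rpow_le_rpow_of_exponent_le one_le_two (by norm_num)).trans (Real.rpow_one 2).le
      norm_num at h4 ⊢
      gcongr
    gcongr
  have hs2 : √(2 / (2 * (s : ℝ) + 1)) ≤ (s : ℝ) ^ (-(1 / 2) : ℝ) := by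
    rw [Real.rpow_neg hs0.le, ← Real.sqrt_eq_rpow, ← Real.sqrt_inv]
    refine Real.sqrt_le_sqrt ?_
    rw [inv_eq_one_div, div_le_div_iff₀ (by positivity) hs0]
    linarith
  calc _ ≤ _ := norm_integral_mul_legendreP_mul_legendreP_le hm n s
    _ ≤ A * d ^ (-β) * (2 * (s : ℝ) ^ (1 / 8 : ℝ)) * √Z * (s : ℝ) ^ (-(1 / 2) : ℝ) :=
        mul_le_mul ((Real.sqrt_le_sqrt hsum).trans hsq) hs2 (Real.sqrt_nonneg _) (by positivity)
    _ = 2 * A * √Z * d ^ (-β) * ((s : ℝ) ^ (1 / 8 : ℝ) * (s : ℝ) ^ (-(1 / 2) : ℝ)) := by ring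
    _ = _ := by rw [← Real.rpow_add hs0]; norm_num

/-- The total power is divided into a part bounded at s = F + 1 or F and a part (s-n)^{-9/8}
summable in s. The latter borrows s^{-(9/8-k)} ≤ (s-n)^{-(9/8-k)}, which requires 9/8 - k ≥ 0; this
is where k ≤ 1 enters. -/
theorem rpow_mul_rpow_le_of_le {k : ℕ} (hk : k ≤ 1) {α : ℝ} (hα : 0 < α) {F n s : ℕ} (hF : 1 ≤ F)
    (hn : n ≤ F) (hs : F < s) :
    (s : ℝ) ^ (-((k : ℝ) + 2 + α)) * (((s - n : ℕ) : ℝ) ^ (-((k : ℝ) + α)) *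
        (s : ℝ) ^ (-(3 / 8) : ℝ)) ≤
      (((F - n : ℕ) : ℝ) + 1) ^ (-α) * (F : ℝ) ^ (-(2 * (k : ℝ) + 5 / 4 + α)) *
        ((s - n : ℕ) : ℝ) ^ (-(9 / 8) : ℝ) := by
  have hk' : (k : ℝ) ≤ 1 := by exact_mod_cast hk
  have hF0 : (0 : ℝ) < F := by exact_mod_cast hF
  have hs0 : (0 : ℝ) < s := by exact_mod_cast (by omega : 0 < s)
  have hFs : (F : ℝ) ≤ s := by exact_mod_cast hs.le
  set d : ℝ := ((s - n : ℕ) : ℝ) with hd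
  set D : ℝ := ((F - n : ℕ) : ℝ) + 1 with hD
  have hD0 : 0 < D := by positivity
  have hDd : D ≤ d := by
    rw [hD, hd]; exact_mod_cast (by omega : F - n + 1 ≤ s - n)
  have hd0 : 0 < d := hD0.trans_le hDd
  have hds : d ≤ s := by rw [hd]; exact_mod_cast Nat.sub_le s n
  have e1 : (s : ℝ) ^ (-((k : ℝ) + 2 + α)) * (s : ℝ) ^ (-(3 / 8) : ℝ) =
      (s : ℝ) ^ (-(2 * (k : ℝ) + 5 / 4 + α)) * (s : ℝ) ^ (-(9 / 8 - (k : ℝ))) := by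
    rw [← Real.rpow_add hs0, ← Real.rpow_add hs0]; congr 1; ring
  have e2 : d ^ (-((k : ℝ) + α)) = d ^ (-α) * d ^ (-(k : ℝ)) := by
    rw [← Real.rpow_add hd0]; congr 1; ring
  have e3 : d ^ (-(9 / 8) : ℝ) = d ^ (-(k : ℝ)) * d ^ (-(9 / 8 - (k : ℝ))) := by
    rw [← Real.rpow_add hd0]; congr 1; ring
  have h1 : (s : ℝ) ^ (-(2 * (k : ℝ) + 5 / 4 + α)) ≤ (F : ℝ) ^ (-(2 * (k : ℝ) + 5 / 4 + α)) :=
    Real.rpow_le_rpow_of_nonpos hF0 hFs (by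
      have : (0 : ℝ) ≤ k := by positivity
      linarith)
  have h2 : (s : ℝ) ^ (-(9 / 8 - (k : ℝ))) ≤ d ^ (-(9 / 8 - (k : ℝ))) :=
    Real.rpow_le_rpow_of_nonpos hd0 hds (by linarith)
  have h3 : d ^ (-α) ≤ D ^ (-α) := Real.rpow_le_rpow_of_nonpos hD0 hDd (by linarith)
  calc _ = d ^ (-((k : ℝ) + α)) * ((s : ℝ) ^ (-((k : ℝ) + 2 + α)) * (s : ℝ) ^ (-(3 / 8) : ℝ)) := by
        ring
    _ = (d ^ (-α) * d ^ (-(k : ℝ))) * ((s : ℝ) ^ (-(2 * (k : ℝ) + 5 / 4 + α)) *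
          (s : ℝ) ^ (-(9 / 8 - (k : ℝ)))) := by rw [e1, e2]
    _ ≤ (D ^ (-α) * d ^ (-(k : ℝ))) * ((F : ℝ) ^ (-(2 * (k : ℝ) + 5 / 4 + α)) *
          d ^ (-(9 / 8 - (k : ℝ)))) := by gcongr
    _ = _ := by rw [e3]; ring

theorem norm_angularIntegral_legendreTail_le {k : ℕ} (hk : k ≤ 1) {α : ℝ} (hα : 0 < α)
    {m u : ℝ → ℝ → ℂ} {ρ A B : ℝ} (hA : 0 ≤ A) (hB : 0 ≤ B)
    (hm : IntervalIntegrable (m ρ) volume (-1) 1) (hu : IntervalIntegrable (u ρ) volume (-1) 1)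
    (hmA : ∀ l : ℕ, 1 ≤ l → ‖legendreCoeff m l ρ‖ ≤ A * (l : ℝ) ^ (-((k : ℝ) + α)))
    (huB : ∀ s : ℕ, 1 ≤ s → ‖legendreCoeff u s ρ‖ ≤ B * (s : ℝ) ^ (-((k : ℝ) + 2 + α)))
    {F n : ℕ} (hF : 1 ≤ F) (hn : n ≤ F) :
    ‖angularIntegral m n (legendreTail F u) ρ‖ ≤
      2 * A * B * √(∑' n : ℕ, (n : ℝ) ^ (-(5 / 4) : ℝ)) * (∑' n : ℕ, (n : ℝ) ^ (-(9 / 8) : ℝ)) *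
        ((((F - n : ℕ) : ℝ) + 1) ^ (-α) * (F : ℝ) ^ (-(2 * (k : ℝ) + 5 / 4 + α))) := by
  set Z := ∑' n : ℕ, (n : ℝ) ^ (-(5 / 4) : ℝ) with hZ
  set G := (((F - n : ℕ) : ℝ) + 1) ^ (-α) * (F : ℝ) ^ (-(2 * (k : ℝ) + 5 / 4 + α)) with hG
  have hG0 : 0 ≤ G := by positivity
  have hk0 : (0 : ℝ) ≤ k := by positivity
  have hsum := hasSum_angularIntegral_legendreTail (F := F)
    (b := fun s => B * (s : ℝ) ^ (-((k : ℝ) + 2 + α))) hm hu (fun s => by positivity)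
    ((summable_natCast_rpow_neg (by linarith)).mul_left B) (fun s hs => huB s (by omega)) n
  -- Reindex by j = s - n, so the terms compare with j^{-9/8}; the dropped terms s < n ≤ F are zero.
  rw [← hasSum_nat_add_iff' n, Finset.sum_eq_zero, sub_zero] at hsum
  swap
  · intro s hs
    rw [if_pos ((Finset.mem_range.mp hs).le.trans hn), zero_mul]
  have hs98 := (summable_natCast_rpow_neg (p := 9 / 8) (by norm_num)).hasSum.mul_left
    (2 * A * B * √Z * G)
  have := tsum_of_norm_bounded hs98 (f := fun j => (if j + n ≤ F then 0 else
      legendreCoeff u (j + n) ρ) * ∫ t in (-1 : ℝ)..1, m ρ t * (((legendreP n).eval t : ℝ) : ℂ) *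
        (((legendreP (j + n)).eval t : ℝ) : ℂ)) fun j => ?_
  · rw [hsum.tsum_eq] at this
    refine this.trans (le_of_eq ?_)
    ring
  · split_ifs with h
    · rw [zero_mul, norm_zero]
      positivity
    · have h1 := huB (j + n) (by omega)
      have h2 := norm_integral_mul_legendreP_mul_legendreP_le_rpow hm hA
        (by linarith : (0 : ℝ) ≤ k + α) hmA (by omega : n < j + n)
      have h3 := rpow_mul_rpow_le_of_le hk hα hF hn (by omega : F < j + n)
      rw [← hZ] at h2
      rw [← hG] at h3
      simp only [Nat.add_sub_cancel] at h2 h3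
      rw [norm_mul]
      calc _ ≤ B * ((j + n : ℕ) : ℝ) ^ (-((k : ℝ) + 2 + α)) *
            (2 * A * √Z * (j : ℝ) ^ (-((k : ℝ) + α)) * ((j + n : ℕ) : ℝ) ^ (-(3 / 8) : ℝ)) :=
            mul_le_mul h1 h2 (norm_nonneg _) (by positivity)
        _ = 2 * A * B * √Z * (((j + n : ℕ) : ℝ) ^ (-((k : ℝ) + 2 + α)) *
            ((j : ℝ) ^ (-((k : ℝ) + α)) * ((j + n : ℕ) : ℝ) ^ (-(3 / 8) : ℝ))) := by ring
        _ ≤ 2 * A * B * √Z * (G * (j : ℝ) ^ (-(9 / 8) : ℝ)) := by gcongr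
        _ = _ := by ring

/-- The mode bound supplies 1/(n+1), the angular bound (F-n+1)^{-α} F^{-(2k+5/4+α)}. Summing over n
contributes F^{1/4-α}, and the exponents add up to -(2k+1+2α). -/
theorem exists_axisymSupNorm_truncOp_legendreTail_le {κ R : ℝ} (hκ : 0 < κ) (hR : 0 < R)
    {k : ℕ} (hk : k ≤ 1) {α : ℝ} (hα0 : 0 < α) (hα1 : α < 1) {A B : ℝ} (hA : 0 ≤ A) (hB : 0 ≤ B) :
    ∃ C : ℝ, ∀ m u : ℝ → ℝ → ℂ,
      (∀ᵐ ρ ∂(volume.restrict (Set.Ioo 0 R)), IntervalIntegrable (m ρ) volume (-1) 1) →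
      (∀ᵐ ρ ∂(volume.restrict (Set.Ioo 0 R)), IntervalIntegrable (u ρ) volume (-1) 1) →
      (∀ l : ℕ, 1 ≤ l → ∀ᵐ ρ ∂(volume.restrict (Set.Ioo 0 R)),
        ‖legendreCoeff m l ρ‖ ≤ A * (l : ℝ) ^ (-((k : ℝ) + α))) →
      (∀ s : ℕ, 1 ≤ s → ∀ᵐ ρ ∂(volume.restrict (Set.Ioo 0 R)),
        ‖legendreCoeff u s ρ‖ ≤ B * (s : ℝ) ^ (-((k : ℝ) + 2 + α))) →
      ∀ F : ℕ, 1 ≤ F → axisymSupNorm (truncOp κ R m F (legendreTail F u)) ≤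
        ENNReal.ofReal (C * (F : ℝ) ^ (-(2 * (k : ℝ) + 1 + 2 * α))) := by
  obtain ⟨K, hK0, hK⟩ := exists_norm_modeOp_le hκ hR
  set Z := ∑' n : ℕ, (n : ℝ) ^ (-(5 / 4) : ℝ) with hZ
  set Y := ∑' n : ℕ, (n : ℝ) ^ (-(9 / 8) : ℝ) with hY
  have hZ0 : 0 ≤ Z := tsum_natCast_rpow_nonneg _
  have hY0 : 0 ≤ Y := tsum_natCast_rpow_nonneg _
  refine ⟨K * (2 * A * B * √Z * Y) * (4 * Z), fun m u hm hu hmA huB F hF => ?_⟩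
  have hF0 : (0 : ℝ) < F := by exact_mod_cast hF
  have hI : ∀ n ≤ F, ∀ᵐ ρ ∂(volume.restrict (Set.Ioo 0 R)),
      ‖angularIntegral m n (legendreTail F u) ρ‖ ≤ 2 * A * B * √Z * Y *
        ((((F - n : ℕ) : ℝ) + 1) ^ (-α) * (F : ℝ) ^ (-(2 * (k : ℝ) + 5 / 4 + α))) := by
    intro n hn
    have hmA' := ae_all_iff.mpr fun l => ae_all_iff.mpr fun hl : 1 ≤ l => hmA l hl
    have huB' := ae_all_iff.mpr fun s => ae_all_iff.mpr fun hs : 1 ≤ s => huB s hs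
    filter_upwards [hm, hu, hmA', huB'] with ρ h1 h2 h3 h4
    exact norm_angularIntegral_legendreTail_le hk hα0 hA hB h1 h2 h3 h4 hF hn
  refine iSup₂_le fun a ha => iSup₂_le fun t ht => ?_
  rw [← ofReal_norm]
  refine ENNReal.ofReal_le_ofReal ?_
  have hterm : ∀ n ∈ Finset.range (F + 1),
      ‖modeOp κ R m n (legendreTail F u) a * (((legendreP n).eval t : ℝ) : ℂ)‖ ≤
        K * (2 * A * B * √Z * Y) * (F : ℝ) ^ (-(2 * (k : ℝ) + 5 / 4 + α)) *
          ((((F - n : ℕ) : ℝ) + 1) ^ (-α) / ((n : ℝ) + 1)) := by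
    intro n hn
    have h1 := hK m (legendreTail F u) n a _ ha (by positivity)
      (hI n (Nat.lt_succ_iff.mp (Finset.mem_range.mp hn)))
    have h2 := abs_eval_legendreP_le_one n ht
    rw [norm_mul, Complex.norm_real, Real.norm_eq_abs]
    calc _ ≤ ‖modeOp κ R m n (legendreTail F u) a‖ * 1 := by gcongr
      _ ≤ _ := by
        rw [mul_one]
        refine h1.trans (le_of_eq ?_)
        ring
  calc ‖truncOp κ R m F (legendreTail F u) a t‖ ≤ _ := norm_sum_le_of_le _ hterm
    _ = K * (2 * A * B * √Z * Y) * (F : ℝ) ^ (-(2 * (k : ℝ) + 5 / 4 + α)) *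
        ∑ n ∈ Finset.range (F + 1), (((F - n : ℕ) : ℝ) + 1) ^ (-α) / ((n : ℝ) + 1) := by
        rw [← Finset.mul_sum]
    _ ≤ K * (2 * A * B * √Z * Y) * (F : ℝ) ^ (-(2 * (k : ℝ) + 5 / 4 + α)) *
        (4 * Z * (F : ℝ) ^ (1 / 4 - α)) :=
        mul_le_mul_of_nonneg_left (sum_harmonic_mul_rpow_le hα0 hα1 hF) (by positivity)
    _ = K * (2 * A * B * √Z * Y) * (4 * Z) *
        ((F : ℝ) ^ (-(2 * (k : ℝ) + 5 / 4 + α)) * (F : ℝ) ^ (1 / 4 - α)) := by ring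
    _ = _ := by
        rw [← Real.rpow_add hF0]
        congr 2
        ring

end Estimates

theorem mainTheorem3 (κ R : ℝ) (hκ : 0 < κ) (hR : 0 < R)
    (k : ℕ) (hk : k = 0 ∨ k = 1) (α : ℝ) (hα0 : 0 < α) (hα1 : α < 1) (A B : ℝ) :
    ∃ C : ℝ, ∀ m u : ℝ → ℝ → ℂ,
      Measurable (Function.uncurry m) → Measurable (Function.uncurry u) →
      (∀ᵐ ρ ∂(volume.restrict (Set.Ioo 0 R)), IntervalIntegrable (m ρ) volume (-1) 1) →
      (∀ᵐ ρ ∂(volume.restrict (Set.Ioo 0 R)), IntervalIntegrable (u ρ) volume (-1) 1) →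
      (∀ l : ℕ, 1 ≤ l → ∀ᵐ ρ ∂(volume.restrict (Set.Ioo 0 R)),
        ‖legendreCoeff m l ρ‖ ≤ A * (l : ℝ) ^ (-((k : ℝ) + α))) →
      (∀ s : ℕ, 1 ≤ s → ∀ᵐ ρ ∂(volume.restrict (Set.Ioo 0 R)),
        ‖legendreCoeff u s ρ‖ ≤ B * (s : ℝ) ^ (-((k : ℝ) + 2 + α))) →
      ∀ F : ℕ, 1 ≤ F →
        (k = 1 → axisymSupNorm (truncOp κ R m F (legendreTail F u)) ≤
          ENNReal.ofReal (C * (F : ℝ) ^ (-(3 + 2 * α)))) ∧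
        (k = 0 → axisymSupNorm (truncOp κ R m F (legendreTail F u)) ≤
          ENNReal.ofReal (C * (F : ℝ) ^ (-(1 + 2 * α)))) := by
  have hk1 : k ≤ 1 := by omega
  -- A and B carry no sign assumption, so the estimate is applied with |A| and |B|, which weakens
  -- the coefficient bounds.
  obtain ⟨C, hC⟩ := exists_axisymSupNorm_truncOp_legendreTail_le hκ hR hk1 hα0 hα1
    (abs_nonneg A) (abs_nonneg B)
  refine ⟨C, fun m u _ _ hm hu hmA huB F hF => ?_⟩
  have key := hC m u hm hu
    (fun l hl => (hmA l hl).mono fun ρ h => h.trans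
      (mul_le_mul_of_nonneg_right (le_abs_self A) (by positivity)))
    (fun s hs => (huB s hs).mono fun ρ h => h.trans
      (mul_le_mul_of_nonneg_right (le_abs_self B) (by positivity))) F hF
  refine ⟨fun h => ?_, fun h => ?_⟩
  · subst h
    convert key using 4
    push_cast
    ring
  · subst h
    convert key using 4
    push_cast
    ring
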